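/- Setup. Consider sequences $\mathbf i=(i_0,i_1,\dots,i_{2l})$ of vertices (labels from an unlimited supply) with $i_{2l}=i_0$, regarded as closed walks with undirected edges $i_{k-1}i_k$, $1\le k\le 2l$. Call $\mathbf i$ an even cycle of length $2l$ if every undirected edge occurs in it an even number of times. The edge $(i_{k-1},i_k)$ and its right endpoint $i_k$ are marked if the number of $j<k$ with $i_{j-1}i_j=i_{k-1}i_k$ (as undirected edges) is even. Two cycles $\mathbf i,\mathbf j$ of length $2l$ are isomorphic if $i_s=i_t\Leftrightarrow j_s=j_t$ for all $0\le s,t\le 2l$. For $l\ge1$ let $\mathcal C(l)$ be the set of isomorphism classes of even cycles of length $2l$ in which exactly $l$ vertices are marked exactly once and $i_0$ is never marked. Let $b_{l,t}$ be the number of pairs consisting of a class in $\mathcal C(l)$ and a vertex $v$ of it of multiplicity $t$, i.e. with $|\{0\le j\le 2l: i_j=v\}|=t$. For $p\in\mathbb N$ and $M>0$ put \[ s(p,M)=\sum_{1\le l\le p-1}M^{2l}\sum_{\substack{1\le t\le p-l+1\\ 0\le l_0\le\min(t/2,\,l)}}\binom{l-l_0+t-1}{l-l_0}\binom{t}{2l_0}\,b_{p-l,t}.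 \] Let $s'(p,M)$ be the same sum with the range of $l_0$ replaced by $0\le l_0\le\min(\tfrac{t-1}2,l)$. Theorem. (a) For all $l\ge1$ and $1\le t\le l+1$, \[ \frac1{4l}\binom{2l+1-t}{l}\le b_{l,t}\le (l+1)^{120}\binom{2l+1-t}{l}. \] (b) Let $D=\{(x,y,z)\in\mathbb R^3: 0\le x\le1,\ 0\le z\le1-x,\ 0\le y\le\min(\tfrac z2,x)\}$ and, for $M>0$ (with $0^0=1$), \[ h(x,y,z)=M^{2x}\,\frac{(x-y+z)^{x-y+z}}{(x-y)^{x-y}(2y)^{2y}(z-2y)^{z-2y}}\cdot\frac{(2-2x-z)^{2-2x-z}}{(1-x)^{1-x}(1-x-z)^{1-x-z}}. \] Then $\sup_D h=4$ if $M\le1$, and $\sup_D h=\dfrac{(M^2+1)^2}{M^2}$ if $M\ge1$. (c) For every $M>0$, \[ \lim_{p\to\infty}s(p,M)^{1/(2p)}=\lim_{p\to\infty}s'(p,M)^{1/(2p)}=f(M):=\begin{cases}2,&M\le1,\\ M+\dfrac1M,&M\ge1.\end{cases} \] -/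

import Mathlib

open Filter Topology

namespace WignerCycles

/-- The undirected edge (loops allowed) traversed at step `k` by the sequence of vertices
`i = (i₀, i₁, …, i_{2l})`. -/
def edge {l : ℕ} (i : Fin (2 * l + 1) → ℕ) (k : Fin (2 * l)) : Sym2 ℕ :=
  s(i k.castSucc, i k.succ)

/-- `i` is an even cycle of length `2l`: it is closed and each undirected edge is traversed an
even number of times. -/
def IsEvenCycle (l : ℕ) (i : Fin (2 * l + 1) → ℕ) : Prop :=
  i (Fin.last (2 * l)) = i 0 ∧ ∀ e : Sym2 ℕ, Even (Set.ncard {k : Fin (2 * l) | edge i k = e})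

/-- Step `k` (and its right endpoint `i (k + 1)`) is marked: an even number of copies of its
undirected edge precede it. -/
def IsMarked {l : ℕ} (i : Fin (2 * l + 1) → ℕ) (k : Fin (2 * l)) : Prop :=
  Even (Set.ncard {j : Fin (2 * l) | j < k ∧ edge i j = edge i k})

/-- The number of times that the vertex `v` is marked. -/
noncomputable def markCount {l : ℕ} (i : Fin (2 * l + 1) → ℕ) (v : ℕ) : ℕ :=
  Set.ncard {k : Fin (2 * l) | IsMarked i k ∧ i k.succ = v}

/-- The even cycles of length `2l` in which exactly `l` vertices are marked exactly once
(`n₁ = l`) and whose first vertex is unmarked. -/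
def EvenCycle (l : ℕ) : Type :=
  {i : Fin (2 * l + 1) → ℕ //
    IsEvenCycle l i ∧ Set.ncard {v : ℕ | markCount i v = 1} = l ∧ markCount i (i 0) = 0}

/-- Two cycles are isomorphic if they have the same pattern of coincidences of vertices. -/
instance cycleSetoid (l : ℕ) : Setoid (EvenCycle l) where
  r i j := ∀ s t : Fin (2 * l + 1), i.1 s = i.1 t ↔ j.1 s = j.1 t
  iseqv := ⟨fun _ _ _ => Iff.rfl, fun h s t => (h s t).symm,
    fun h h' s t => (h s t).trans (h' s t)⟩

/-- `𝒞(l)`: the isomorphism classes of such cycles. -/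
def CycleClass (l : ℕ) : Type := Quotient (cycleSetoid l)

/-- The multiplicity of the vertex `v` in the sequence `(i₀, …, i_{2l})`. -/
noncomputable def multiplicity {l : ℕ} (i : Fin (2 * l + 1) → ℕ) (v : ℕ) : ℕ :=
  Set.ncard {j : Fin (2 * l + 1) | i j = v}

/-- The number of vertices of multiplicity `t` of the cycle `i`. -/
noncomputable def vertexCount {l : ℕ} (t : ℕ) (i : Fin (2 * l + 1) → ℕ) : ℕ :=
  Set.ncard {v : ℕ | v ∈ Set.range i ∧ multiplicity i v = t}

theorem vertexCount_congr {l : ℕ} (t : ℕ) (i j : EvenCycle l) (h : i ≈ j) :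
    vertexCount t i.1 = vertexCount t j.1 := by
  have h' : ∀ a b : Fin (2 * l + 1), i.1 a = i.1 b ↔ j.1 a = j.1 b := h
  have hm : ∀ a, multiplicity i.1 (i.1 a) = multiplicity j.1 (j.1 a) := by
    intro a
    unfold multiplicity
    congr 1
    ext b
    exact h' b a
  have hi : ∀ v ∈ Set.range i.1, ∃ a, i.1 a = v := fun v hv => hv
  unfold vertexCount
  refine Set.ncard_congr (fun v hv => j.1 (Classical.choose (hi v hv.1))) ?_ ?_ ?_
  · intro v hv
    refine ⟨⟨_, rfl⟩, ?_⟩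
    rw [← hm, Classical.choose_spec (hi v hv.1)]
    exact hv.2
  · intro v w hv hw hvw
    have := (h' _ _).2 hvw
    rwa [Classical.choose_spec (hi v hv.1), Classical.choose_spec (hi w hw.1)] at this
  · rintro w ⟨⟨a, rfl⟩, hw⟩
    refine ⟨i.1 a, ⟨⟨a, rfl⟩, by rw [hm]; exact hw⟩, ?_⟩
    exact (h' _ _).1 (Classical.choose_spec (hi (i.1 a) ⟨a, rfl⟩))

instance finite_cycleClass (l : ℕ) : Finite (CycleClass l) := by
  let F : CycleClass l → (Fin (2 * l + 1) → Fin (2 * l + 1) → Prop) :=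
    Quotient.lift (fun i s t => i.1 s = i.1 t)
      (fun i j h => funext fun s => funext fun t => propext (h s t))
  refine Finite.of_injective F ?_
  intro x y
  induction x using Quotient.inductionOn with
  | h i =>
    induction y using Quotient.inductionOn with
    | h j =>
      intro hxy
      refine Quotient.sound fun s t => ?_
      exact iff_of_eq (congrFun (congrFun hxy s) t)

noncomputable instance fintype_cycleClass (l : ℕ) : Fintype (CycleClass l) :=
  Fintype.ofFinite _

/-- `b_{l,t}`: the total number, over all `c ∈ 𝒞(l)`, of vertices of multiplicity `t` in `c`. -/
noncomputable def b (l t : ℕ) : ℕ :=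
  ∑ c : CycleClass l, Quotient.lift (fun i : EvenCycle l => vertexCount t i.1)
    (fun i j h => vertexCount_congr t i j h) c

/-- The polynomial `s(p, M)`, with inner summation range `0 ≤ l₀ ≤ min (t / 2, l)`. -/
noncomputable def s (p : ℕ) (M : ℝ) : ℝ :=
  ∑ l ∈ Finset.Icc 1 (p - 1), M ^ (2 * l) *
    ∑ t ∈ Finset.Icc 1 (p - l + 1), ∑ l₀ ∈ Finset.range (l + 1) with 2 * l₀ ≤ t,
      (((l - l₀ + t - 1).choose (l - l₀) * t.choose (2 * l₀) * b (p - l) t : ℕ) : ℝ)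

/-- The variant of `s(p, M)` with inner summation range `0 ≤ l₀ ≤ min ((t - 1) / 2, l)`. -/
noncomputable def s' (p : ℕ) (M : ℝ) : ℝ :=
  ∑ l ∈ Finset.Icc 1 (p - 1), M ^ (2 * l) *
    ∑ t ∈ Finset.Icc 1 (p - l + 1), ∑ l₀ ∈ Finset.range (l + 1) with 2 * l₀ ≤ t - 1,
      (((l - l₀ + t - 1).choose (l - l₀) * t.choose (2 * l₀) * b (p - l) t : ℕ) : ℝ)

/-- The limit function `f`. -/
noncomputable def f (M : ℝ) : ℝ := if M ≤ 1 then 2 else M + 1 / M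

/-- The polytope `D` of triples `(x, y, z)`. -/
def D : Set (ℝ × ℝ × ℝ) :=
  {w | 0 ≤ w.1 ∧ w.1 ≤ 1 ∧ 0 ≤ w.2.2 ∧ w.2.2 ≤ 1 - w.1 ∧
    0 ≤ w.2.1 ∧ w.2.1 ≤ min (w.2.2 / 2) w.1}

/-- The function `h` on triples `(x, y, z)`; real powers satisfy `0 ^ 0 = 1`. -/
noncomputable def h (M : ℝ) : ℝ × ℝ × ℝ → ℝ := fun (x, y, z) =>
  M ^ (2 * x) *
    ((x - y + z) ^ (x - y + z) /
      ((x - y) ^ (x - y) * (2 * y) ^ (2 * y) * (z - 2 * y) ^ (z - 2 * y))) *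
    ((2 - 2 * x - z) ^ (2 - 2 * x - z) /
      ((1 - x) ^ (1 - x) * (1 - x - z) ^ (1 - x - z)))

end WignerCycles

/-! The cycles in question are contours of plane trees. If `l` vertices are marked exactly once and
the root never, then, since exactly `l` of the `2l` steps are marked, every marked step reaches a
new vertex. By induction the edges traversed an odd number of times form the simple path from the
current vertex back to the root, so an unmarked step must go back along that path. Hence the walk is
a depth-first exploration, and recording which steps are marked identifies `𝒞(l)` with the Dyck
words of length `2l` (`equiv_of_markWord_eq`, `exists_markWord_eq`). A vertex first met at time `p`
has multiplicity one plus the number of excursions that the path makes above its level at time `p`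
before going below it.

(a) An up-step leaving the reference level is forced once the number of remaining excursions is
known. Deleting these `t - 1` letters is injective, which gives at most `(2l+1-t).choose l` words
for each time `p`, and so the upper bound with the factor `2l+1` (`b_le`). For the lower bound it
suffices to count roots when `t > 1`, by a ballot number, and to find one leaf in every tree when `t
= 1` (`le_b`).

(b) `M^{2x}` is `(M²+1)²/M²` times a product of powers of two probability vectors (`weights_mul`).
Gibbs' inequality `T^T ∏ rᵢ^{aᵢ} ≤ ∏ aᵢ^{aᵢ}`, with `T = ∑ aᵢ` and `∑ rᵢ = 1`, then bounds `h`;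
equality holds when the `aᵢ` are proportional to the `rᵢ`, which happens at a point of `D` if `M ≥
1`. For `M ≤ 1` one compares with `M = 1`.

(c) The sums are evaluated directly, without (b). The sum over `l₀` collapses by `(1-X)^{-t} =
(1+X)^t (1-X²)^{-t}`; after replacing `b` by its binomial at polynomial cost, the sum over `t` is a
Vandermonde convolution equal to `(2p+1).choose (p+l+1)`. What remains is essentially half of the
binomial expansion of `(M+1/M)^{2p+1}` (`comparisonSum_bounds`). Finally `s' ≤ s ≤ 2 s'`, and
polynomial factors disappear under the `2p`-th root. -/

namespace WignerCycles

/-! ### Lattice words: excursions, visits and counting -/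

/-- The number of up-steps (`true`) that a lattice path starting at level `d` makes from level `0`
before it goes below level `0`. -/
def departures : ℕ → List Bool → ℕ
  | _, [] => 0
  | 0, true :: w => departures 1 w + 1
  | 0, false :: _ => 0
  | d + 1, true :: w => departures (d + 2) w
  | d + 1, false :: w => departures d w

/-- The indicators of the times at which a lattice path starting at level `d` is at level `0`,
up to the time when it goes below level `0`. -/
def visitList : ℕ → List Bool → List Bool
  | 0, [] => [true]
  | _ + 1, [] => [false]
  | 0, true :: w => true :: visitList 1 w
  | 0, false :: w => true :: List.replicate (w.length + 1) false
  | d + 1, true :: w => false :: visitList (d + 2) w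
  | d + 1, false :: w => false :: visitList d w

/-- The lattice path starting at level `d` stays nonnegative and ends at level `0`. -/
def IsDyck : ℕ → List Bool → Prop
  | d, [] => d = 0
  | d, true :: w => IsDyck (d + 1) w
  | 0, false :: _ => False
  | d + 1, false :: w => IsDyck d w

theorem departures_le_length (d : ℕ) (w : List Bool) : departures d w ≤ w.length := by
  induction w generalizing d with
  | nil => cases d <;> simp [departures]
  | cons a w ih =>
    cases d <;> cases a <;> simp only [departures, List.length_cons]
    · omega
    · have := ih 1; omega
    · rename_i d; have := ih d; omega
    · rename_i d; have := ih (d + 2); omega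

/-- A path which ends at or below level `0` returns after each departure from level `0`. -/
theorem count_visitList {d : ℕ} {w : List Bool} (h : d + w.count true ≤ w.count false) :
    (visitList d w).count true = departures d w + 1 := by
  induction w generalizing d with
  | nil =>
    simp at h
    subst h
    simp [visitList, departures]
  | cons a w ih =>
    cases d <;> cases a <;> simp [visitList, departures] at h ⊢
    · simp [List.count_replicate]
    · apply ih; omega
    · apply ih; omega
    · apply ih; omega

theorem IsDyck.count {d : ℕ} {w : List Bool} (h : IsDyck d w) :
    d + w.count true = w.count false := by
  induction w generalizing d with
  | nil => simpa [IsDyck] using h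
  | cons a w ih =>
    cases d <;> cases a <;> simp [IsDyck] at h ⊢
    · have := ih h; omega
    · have := ih h; omega
    · have := ih h; omega

theorem finite_lists (m : ℕ) (P : List Bool → Prop) :
    {w : List Bool | w.length = m ∧ P w}.Finite :=
  (List.finite_length_eq Bool m).subset fun _ h => h.1

/-- Splitting by the first letter; this and its reverse `le_ncard_of_cons` turn the counts below
into inductions by Pascal's rule. -/
theorem ncard_le_of_cons {P P₁ P₂ : Set (List Bool)} (h₁ : P₁.Finite) (h₂ : P₂.Finite)
    (hnil : [] ∉ P) (ht : ∀ w, true :: w ∈ P → w ∈ P₁) (hf : ∀ w, false :: w ∈ P → w ∈ P₂) :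
    P.ncard ≤ P₁.ncard + P₂.ncard := by
  have hsub : P ⊆ (true :: ·) '' P₁ ∪ (false :: ·) '' P₂ := by
    intro w hw
    match w, hw with
    | [], hw => exact absurd hw hnil
    | true :: w, hw => exact Or.inl ⟨w, ht w hw, rfl⟩
    | false :: w, hw => exact Or.inr ⟨w, hf w hw, rfl⟩
  calc P.ncard ≤ _ := Set.ncard_le_ncard hsub ((h₁.image _).union (h₂.image _))
    _ ≤ _ := Set.ncard_union_le _ _
    _ ≤ _ := add_le_add (Set.ncard_image_le h₁) (Set.ncard_image_le h₂)

theorem le_ncard_of_cons {P P₁ P₂ : Set (List Bool)} (hP : P.Finite)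
    (ht : ∀ w ∈ P₁, true :: w ∈ P) (hf : ∀ w ∈ P₂, false :: w ∈ P) :
    P₁.ncard + P₂.ncard ≤ P.ncard := by
  have hsub : (true :: ·) '' P₁ ∪ (false :: ·) '' P₂ ⊆ P := by
    rintro _ (⟨w, hw, rfl⟩ | ⟨w, hw, rfl⟩)
    exacts [ht w hw, hf w hw]
  have hdisj : Disjoint ((true :: ·) '' P₁) ((false :: ·) '' P₂) := by
    rw [Set.disjoint_left]
    rintro _ ⟨w, _, rfl⟩ ⟨v, _, hv⟩
    simp at hv
  have hu := hP.subset hsub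
  calc P₁.ncard + P₂.ncard
      = ((true :: ·) '' P₁).ncard + ((false :: ·) '' P₂).ncard := by
        rw [Set.ncard_image_of_injective _ List.cons_injective,
          Set.ncard_image_of_injective _ List.cons_injective]
    _ = _ := (Set.ncard_union_eq hdisj (hu.subset Set.subset_union_left)
        (hu.subset Set.subset_union_right)).symm
    _ ≤ _ := Set.ncard_le_ncard hsub hP

theorem ncard_words_le (m D : ℕ) :
    {w : List Bool | w.length = m ∧ w.count false = D}.ncard ≤ m.choose D := by
  induction m generalizing D with
  | zero =>
    rcases D with _ | D
    · refine (Set.ncard_le_ncard (t := {[]}) ?_ (Set.finite_singleton _)).trans (by simp)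
      rintro w ⟨hw, -⟩
      simpa using hw
    · rw [show {w : List Bool | w.length = 0 ∧ w.count false = D + 1} = ∅ by
        ext w; simp +contextual]
      simp
  | succ m ih =>
    rcases D with _ | D
    · refine (ncard_le_of_cons (P₂ := ∅) (finite_lists m _) Set.finite_empty (by simp)
        (P₁ := {w : List Bool | w.length = m ∧ w.count false = 0}) ?_ ?_).trans ?_
      · intro w hw; simpa using hw
      · intro w hw; simp at hw
      · simpa using ih 0
    · refine (ncard_le_of_cons (finite_lists m _) (finite_lists m _) (by simp)
        (P₁ := {w : List Bool | w.length = m ∧ w.count false = D + 1})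
        (P₂ := {w : List Bool | w.length = m ∧ w.count false = D}) ?_ ?_).trans ?_
      · intro w hw; simpa using hw
      · intro w hw; simpa using hw
      · rw [Nat.choose_succ_succ, add_comm]; exact add_le_add (ih _) (ih _)

/-- At level `0` with departures still to come, the next letter has to be `true`. Deleting these `k`
forced letters loses no information and leaves `n` letters that contain all the `D` down-steps. -/
theorem ncard_departures_le (d k n D : ℕ) :
    {w : List Bool | w.length = k + n ∧ w.count false = D ∧ departures d w = k}.ncard
      ≤ n.choose D := by
  obtain ⟨m, hm⟩ : ∃ m, m = k + n := ⟨_, rfl⟩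
  rw [← hm]
  induction m generalizing d k n D with
  | zero =>
    obtain ⟨rfl, rfl⟩ : k = 0 ∧ n = 0 := by omega
    refine (Set.ncard_le_ncard ?_ (finite_lists 0 _)).trans (ncard_words_le 0 D)
    exact fun w hw => ⟨hw.1, hw.2.1⟩
  | succ m ih =>
    rcases d with _ | d
    · rcases k with _ | k
      · obtain rfl : n = m + 1 := by omega
        refine (Set.ncard_le_ncard ?_ (finite_lists _ _)).trans (ncard_words_le (m + 1) D)
        exact fun w hw => ⟨hw.1, hw.2.1⟩
      · refine (ncard_le_of_cons (P₂ := ∅) (finite_lists m _) Set.finite_empty (by simp)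
          (P₁ := {w : List Bool | w.length = m ∧ w.count false = D ∧ departures 1 w = k})
          ?_ ?_).trans ?_
        · intro w hw; simpa [departures] using hw
        · intro w hw; simp [departures] at hw
        · simpa using ih 1 k n D (by omega)
    · rcases n with _ | n
      · rw [show {w : List Bool | w.length = m + 1 ∧ w.count false = D ∧
          departures (d + 1) w = k} = ∅ from ?_]
        · simp
        · rw [Set.eq_empty_iff_forall_notMem]
          rintro w ⟨h1, -, h2⟩
          match w, h1, h2 with
          | true :: w, h1, h2 =>
            have := departures_le_length (d + 2) w
            simp [departures] at h1 h2; omega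
          | false :: w, h1, h2 =>
            have := departures_le_length d w
            simp [departures] at h1 h2; omega
      · rcases D with _ | D
        · refine (ncard_le_of_cons (P₂ := ∅) (finite_lists m _) Set.finite_empty (by simp)
            (P₁ := {w : List Bool | w.length = m ∧ w.count false = 0 ∧ departures (d + 2) w = k})
            ?_ ?_).trans ?_
          · intro w hw; simpa [departures] using hw
          · intro w hw; simp at hw
          · simpa using ih (d + 2) k n 0 (by omega)
        · refine (ncard_le_of_cons (finite_lists m _) (finite_lists m _) (by simp)
            (P₁ := {w : List Bool | w.length = m ∧ w.count false = D + 1 ∧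
              departures (d + 2) w = k})
            (P₂ := {w : List Bool | w.length = m ∧ w.count false = D ∧ departures d w = k})
            ?_ ?_).trans ?_
          · intro w hw; simpa [departures] using hw
          · intro w hw; simpa [departures] using hw
          · rw [Nat.choose_succ_succ, add_comm]
            exact add_le_add (ih _ _ _ _ (by omega)) (ih _ _ _ _ (by omega))

/-- The first `p` letters are free, so each of them contributes one application of Pascal's rule
before the previous bound takes over. -/
theorem ncard_departures_drop_le (p k n D : ℕ) :
    {w : List Bool | w.length = k + n ∧ w.count false = D ∧ departures 0 (w.drop p) = k}.ncard
      ≤ n.choose D := by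
  obtain ⟨m, hm⟩ : ∃ m, m = k + n := ⟨_, rfl⟩
  rw [← hm]
  induction p generalizing m n D with
  | zero => simpa [hm] using ncard_departures_le 0 k n D
  | succ p ih =>
    rcases m with _ | m
    · obtain ⟨rfl, rfl⟩ : k = 0 ∧ n = 0 := by omega
      refine (Set.ncard_le_ncard ?_ (finite_lists 0 _)).trans (ncard_words_le 0 D)
      exact fun w hw => ⟨hw.1, hw.2.1⟩
    · rcases n with _ | n
      · rw [show {w : List Bool | w.length = m + 1 ∧ w.count false = D ∧
          departures 0 (w.drop (p + 1)) = k} = ∅ from ?_]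
        · simp
        · rw [Set.eq_empty_iff_forall_notMem]
          rintro w ⟨h1, -, h2⟩
          have := departures_le_length 0 (w.drop (p + 1))
          simp only [List.length_drop] at this
          omega
      · rcases D with _ | D
        · refine (ncard_le_of_cons (P₂ := ∅) (finite_lists m _) Set.finite_empty (by simp)
            (P₁ := {w : List Bool | w.length = m ∧ w.count false = 0 ∧
              departures 0 (w.drop p) = k}) ?_ ?_).trans ?_
          · intro w hw; simpa using hw
          · intro w hw; simp at hw
          · simpa using ih n 0 m (by omega)
        · refine (ncard_le_of_cons (finite_lists m _) (finite_lists m _) (by simp)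
            (P₁ := {w : List Bool | w.length = m ∧ w.count false = D + 1 ∧
              departures 0 (w.drop p) = k})
            (P₂ := {w : List Bool | w.length = m ∧ w.count false = D ∧
              departures 0 (w.drop p) = k}) ?_ ?_).trans ?_
          · intro w hw; simpa using hw
          · intro w hw; simpa using hw
          · rw [Nat.choose_succ_succ, add_comm]
            exact add_le_add (ih _ _ _ (by omega)) (ih _ _ _ (by omega))

/-- The Dyck paths from level `d` with `U + k` up-steps, `k` of which start at level `0`. -/
def dyckSet (U d k : ℕ) : Set (List Bool) :=
  {w | w.length = 2 * U + 2 * k + d ∧ IsDyck d w ∧ departures d w = k}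

theorem finite_dyckSet (U d k : ℕ) : (dyckSet U d k).Finite := finite_lists _ _

theorem dyckSet_zero : (dyckSet 0 0 0).ncard = 1 := by
  rw [show dyckSet 0 0 0 = {[]} from ?_, Set.ncard_singleton]
  ext w
  simp only [dyckSet, Set.mem_ofPred_eq, Set.mem_singleton_iff]
  constructor
  · intro h; simpa using h.1
  · rintro rfl; simp [IsDyck, departures]

/-- The reflection principle. Deleting the `k` departing up-steps turns such a path into one from
`d` that first hits `-k` at its last step; the two binomials count all paths of the first `n` steps
and those that hit `-k` too early. The induction checks that both sides obey the same first-letter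
recursion. -/
theorem choose_le_ncard_dyckSet (U d k n : ℕ) (hn : n + 1 = 2 * U + d + k) :
    n.choose U ≤ (dyckSet U d k).ncard + n.choose (U + d + k) := by
  obtain ⟨m, hm⟩ : ∃ m, m = 2 * U + 2 * k + d := ⟨_, rfl⟩
  induction m generalizing U d k n with
  | zero => omega
  | succ m ih =>
    rcases d with _ | d
    · rcases k with _ | k
      · simp
      · have h1 := le_ncard_of_cons (P := dyckSet U 0 (k + 1)) (P₁ := dyckSet U 1 k) (P₂ := ∅)
          (finite_dyckSet _ _ _) (by
            rintro w ⟨h1, h2, h3⟩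
            refine ⟨by simp only [List.length_cons]; omega, by simpa [IsDyck] using h2,
              by simpa [departures] using h3⟩) (by simp)
        have h2 := ih U 1 k n (by omega) (by omega)
        rw [show U + 1 + k = U + 0 + (k + 1) by omega] at h2
        simp at h1 h2 ⊢
        omega
    · have hf : ∀ w ∈ dyckSet U d k, false :: w ∈ dyckSet U (d + 1) k := by
        rintro w ⟨h1, h2, h3⟩
        exact ⟨by simp only [List.length_cons]; omega, by simpa [IsDyck] using h2,
              by simpa [departures] using h3⟩
      have hG : ∀ n', n' + 1 = n →
          n'.choose U ≤ (dyckSet U d k).ncard + n'.choose (U + d + k) := fun n' h =>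
        ih U d k n' (by omega) (by omega)
      rcases U with _ | U
      · have h1 := le_ncard_of_cons (P₁ := ∅) (finite_dyckSet _ _ _) (by simp) hf
        rcases n with _ | n
        · obtain ⟨rfl, rfl⟩ : d = 0 ∧ k = 0 := by omega
          rw [dyckSet_zero] at h1
          simp at h1 ⊢
          omega
        · have h2 := hG n rfl
          rw [Nat.choose_eq_zero_of_lt (show n < 0 + d + k by omega)] at h2
          simp at h1 h2 ⊢
          omega
      · have ht : ∀ w ∈ dyckSet U (d + 2) k, true :: w ∈ dyckSet (U + 1) (d + 1) k := by
          rintro w ⟨h1, h2, h3⟩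
          exact ⟨by simp only [List.length_cons]; omega, by simpa [IsDyck] using h2,
              by simpa [departures] using h3⟩
        have h1 := le_ncard_of_cons (finite_dyckSet _ _ _) ht hf
        obtain ⟨n, rfl⟩ : ∃ n', n = n' + 1 := ⟨n - 1, by omega⟩
        have h2 := hG n rfl
        have h3 := ih U (d + 2) k n (by omega) (by omega)
        rw [Nat.choose_succ_succ', show U + 1 + (d + 1) + k = (U + 1 + d + k) + 1 by ring,
          Nat.choose_succ_succ']
        rw [show U + (d + 2) + k = (U + 1 + d + k) + 1 by ring] at h3
        omega

/-! ### Parity of edges along a walk -/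

/-- The undirected edge traversed at step `k` of the infinite walk `x`. -/
def walkEdge (x : ℕ → ℕ) (k : ℕ) : Sym2 ℕ := s(x k, x (k + 1))

/-- The edges traversed an odd number of times during the first `k` steps. -/
def oddEdges (x : ℕ → ℕ) : ℕ → Finset (Sym2 ℕ)
  | 0 => ∅
  | k + 1 => if walkEdge x k ∈ oddEdges x k then (oddEdges x k).erase (walkEdge x k)
      else insert (walkEdge x k) (oddEdges x k)

theorem mem_oddEdges (x : ℕ → ℕ) (k : ℕ) (e : Sym2 ℕ) :
    e ∈ oddEdges x k ↔ Odd ((Finset.range k).filter (fun j => walkEdge x j = e)).card := by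
  induction k with
  | zero => simp [oddEdges]
  | succ k ih =>
    rw [Finset.range_add_one, Finset.filter_insert, oddEdges]
    by_cases he : walkEdge x k = e
    · subst he
      rw [if_pos rfl, Finset.card_insert_of_notMem (by simp), Nat.odd_add_one, ← ih]
      split_ifs with h <;> simp [h]
    · rw [if_neg he, ← ih]
      split_ifs with h <;> simp [Ne.symm he]

/-- A marked step adds its edge to the odd set and an unmarked one removes it. If the final set is
empty, half of the steps are therefore marked. -/
theorem card_oddEdges (x : ℕ → ℕ) (k : ℕ) :
    (oddEdges x k).card + ((Finset.range k).filter (fun j => walkEdge x j ∈ oddEdges x j)).card =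
      ((Finset.range k).filter (fun j => walkEdge x j ∉ oddEdges x j)).card := by
  induction k with
  | zero => simp [oddEdges]
  | succ k ih =>
    rw [Finset.range_add_one, Finset.filter_insert, Finset.filter_insert, oddEdges]
    by_cases h : walkEdge x k ∈ oddEdges x k
    · have := Finset.card_pos.2 ⟨_, h⟩
      simp only [h, if_true, not_true, if_false]
      rw [Finset.card_insert_of_notMem (by simp), Finset.card_erase_of_mem h]
      omega
    · simp only [h, if_false, not_false_eq_true, if_true]
      rw [Finset.card_insert_of_notMem h, Finset.card_insert_of_notMem (by simp)]
      omega

theorem card_marked {x : ℕ → ℕ} {l : ℕ} (h : oddEdges x (2 * l) = ∅) :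
    ((Finset.range (2 * l)).filter (fun j => walkEdge x j ∉ oddEdges x j)).card = l := by
  have h1 := card_oddEdges x (2 * l)
  have h2 := Finset.card_filter_add_card_filter_not (s := Finset.range (2 * l))
    (fun j => walkEdge x j ∈ oddEdges x j)
  rw [h] at h1
  simp only [Finset.card_empty, Finset.card_range] at h1 h2
  omega

/-- The edges between consecutive vertices of a list. -/
def listEdges : List ℕ → Finset (Sym2 ℕ)
  | [] => ∅
  | [_] => ∅
  | a :: b :: T => insert s(a, b) (listEdges (b :: T))

theorem mem_of_mem_listEdges {a c : ℕ} {L : List ℕ} (h : s(a, c) ∈ listEdges L) : a ∈ L := by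
  induction L with
  | nil => simp [listEdges] at h
  | cons b T ih =>
    cases T with
    | nil => simp [listEdges] at h
    | cons d T =>
      rw [listEdges, Finset.mem_insert, Sym2.eq_iff] at h
      rcases h with (⟨rfl, rfl⟩ | ⟨rfl, rfl⟩) | h
      · simp
      · simp
      · exact List.mem_cons_of_mem _ (ih h)

/-- On a simple path the end vertex lies on a single edge. This is what forces an unmarked step to
backtrack. -/
theorem eq_cons_of_mem_listEdges {a c : ℕ} {L : List ℕ} (hn : (a :: L).Nodup)
    (h : s(a, c) ∈ listEdges (a :: L)) : ∃ T, L = c :: T := by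
  cases L with
  | nil => simp [listEdges] at h
  | cons d T =>
    rw [listEdges, Finset.mem_insert, Sym2.eq_iff] at h
    rcases h with (⟨-, rfl⟩ | ⟨rfl, rfl⟩) | h
    · exact ⟨_, rfl⟩
    · exact ⟨_, rfl⟩
    · exact absurd (mem_of_mem_listEdges h) (List.nodup_cons.1 hn).1

/-! ### Depth-first walks and their Dyck words -/

/-- The first `N` steps of the walk `x` explore a tree in depth-first order: `S k` is the path from
the vertex at time `k` to the root, and `w k` says whether step `k` goes to a new vertex. -/
structure StackWalk (N : ℕ) (x : ℕ → ℕ) (w : ℕ → Bool) (S : ℕ → List ℕ) : Prop where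
  start : S 0 = [x 0]
  final : S N = [x 0]
  head : ∀ k ≤ N, ∃ T, S k = x k :: T
  nodup : ∀ k ≤ N, (S k).Nodup
  seen : ∀ k ≤ N, ∀ v ∈ S k, ∃ j ≤ k, x j = v
  push : ∀ k < N, w k = true → S (k + 1) = x (k + 1) :: S k
  fresh : ∀ k < N, w k = true → ∀ j ≤ k, x j ≠ x (k + 1)
  pop : ∀ k < N, w k = false → S k = x k :: S (k + 1)

theorem oddEdges_pop {x : ℕ → ℕ} {k : ℕ} {T : List ℕ} (hn : (x k :: x (k + 1) :: T).Nodup)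
    (h : oddEdges x k = listEdges (x k :: x (k + 1) :: T)) :
    walkEdge x k ∈ oddEdges x k ∧ oddEdges x (k + 1) = listEdges (x (k + 1) :: T) := by
  have hmem : walkEdge x k ∈ oddEdges x k := by
    rw [h, listEdges]
    exact Finset.mem_insert_self _ _
  refine ⟨hmem, ?_⟩
  rw [oddEdges, if_pos hmem, h, listEdges]
  exact Finset.erase_insert fun h' => (List.nodup_cons.1 hn).1 (mem_of_mem_listEdges h')

theorem oddEdges_push {x : ℕ → ℕ} {k : ℕ} {T : List ℕ} (hn : x (k + 1) ∉ x k :: T)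
    (h : oddEdges x k = listEdges (x k :: T)) :
    walkEdge x k ∉ oddEdges x k ∧ oddEdges x (k + 1) = listEdges (x (k + 1) :: x k :: T) := by
  have hmem : walkEdge x k ∉ oddEdges x k := by
    rw [h, walkEdge, Sym2.eq_swap]
    exact fun h' => hn (mem_of_mem_listEdges h')
  refine ⟨hmem, ?_⟩
  rw [oddEdges, if_neg hmem, h, listEdges, walkEdge, Sym2.eq_swap]

namespace StackWalk

variable {N : ℕ} {x : ℕ → ℕ} {w : ℕ → Bool} {S : ℕ → List ℕ}

theorem notMem (H : StackWalk N x w S) {k : ℕ} (hk : k < N) (hw : w k = true) :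
    x (k + 1) ∉ S k := by
  intro h
  obtain ⟨j, hj, e⟩ := H.seen k hk.le _ h
  exact H.fresh k hk hw j hj e

/-- The key invariant: the edges of odd parity are those on the path to the root. A push adds the
new top edge, and a pop removes it. -/
theorem oddEdges_eq (H : StackWalk N x w S) {k : ℕ} (hk : k ≤ N) :
    oddEdges x k = listEdges (S k) := by
  induction k with
  | zero => simp [H.start, oddEdges, listEdges]
  | succ k ih =>
    have ih := ih (by omega)
    obtain ⟨T, hT⟩ := H.head k (by omega)
    cases hw : w k with
    | true =>
      have hn := H.notMem hk hw
      rw [H.push k hk hw]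
      rw [hT] at hn ih ⊢
      exact (oddEdges_push hn ih).2
    | false =>
      obtain ⟨T', hT'⟩ := H.head (k + 1) hk
      have hn := H.nodup k (by omega)
      have hp := H.pop k hk hw
      rw [hT'] at hp
      rw [hp] at ih hn
      rw [hT']
      exact (oddEdges_pop hn ih).2

theorem marked_iff (H : StackWalk N x w S) {k : ℕ} (hk : k < N) :
    walkEdge x k ∉ oddEdges x k ↔ w k = true := by
  have ih := H.oddEdges_eq hk.le
  cases hw : w k with
  | true =>
    have hn := H.notMem hk hw
    obtain ⟨T, hT⟩ := H.head k hk.le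
    rw [hT] at hn ih
    simpa using (oddEdges_push hn ih).1
  | false =>
    obtain ⟨T', hT'⟩ := H.head (k + 1) hk
    have hn := H.nodup k (by omega)
    have hp := H.pop k hk hw
    rw [hT'] at hp
    rw [hp] at ih hn
    simpa using (oddEdges_pop hn ih).1

theorem closed (H : StackWalk N x w S) : x N = x 0 := by
  obtain ⟨T, hT⟩ := H.head N le_rfl
  rw [H.final] at hT
  simp at hT
  exact hT.1.symm

theorem oddEdges_final (H : StackWalk N x w S) : oddEdges x N = ∅ := by
  rw [H.oddEdges_eq le_rfl, H.final, listEdges]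

/-- A vertex which has been left for good does not recur. -/
theorem ne_of_notMem (H : StackWalk N x w S) {j k : ℕ} (hj : j ≤ k)
    (hn : x j ∉ S k) {i : ℕ} (hki : k ≤ i) (hi : i ≤ N) : x j ∉ S i := by
  induction i, hki using Nat.le_induction with
  | base => exact hn
  | succ i hki ih =>
    have ih := ih (by omega)
    cases hw : w i with
    | true =>
      rw [H.push i hi hw, List.mem_cons, not_or]
      exact ⟨H.fresh i hi hw j (by omega), ih⟩
    | false =>
      rw [H.pop i hi hw] at ih
      exact fun h => ih (List.mem_cons_of_mem _ h)

theorem mem_stack (H : StackWalk N x w S) {k : ℕ} (hk : k ≤ N) : x k ∈ S k := by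
  obtain ⟨T, hT⟩ := H.head k hk
  simp [hT]

theorem head_eq (H : StackWalk N x w S) {k : ℕ} (hk : k ≤ N) : (S k)[0]? = some (x k) := by
  obtain ⟨T, hT⟩ := H.head k hk
  simp [hT]

/-- If `v` is at depth `d` of the stack, the height of the walk above `v` evolves by the letters of
`w`. The walk is at `v` when this height is `0`, and never again after `v` is popped; so the word
determines all visits. -/
theorem map_visits (H : StackWalk N x w S) {k m d v : ℕ} (hkm : k + m = N)
    (hv : (S k)[d]? = some v) :
    (List.range' k (m + 1)).map (fun i => decide (x i = v)) =
      visitList d ((List.range' k m).map w) := by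
  induction m generalizing k d with
  | zero =>
    obtain rfl : k = N := by omega
    have hf := H.final
    rw [hf] at hv
    cases d with
    | zero =>
      have := H.closed
      simp at hv
      simp [visitList, this, hv]
    | succ d => simp at hv
  | succ m ih =>
    obtain ⟨T, hT⟩ := H.head k (by omega)
    have hn := H.nodup k (by omega)
    rw [List.range'_succ, List.map_cons]
    rw [show List.range' k (m + 1) = k :: List.range' (k + 1) m from List.range'_succ ..,
      List.map_cons]
    cases hw : w k with
    | true =>
      have hp := H.push k (by omega) hw
      have := ih (k := k + 1) (d := d + 1) (by omega) (by rw [hp]; simpa using hv)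
      cases d with
      | zero =>
        rw [H.head_eq (by omega)] at hv
        simp only [Option.some.injEq] at hv
        rw [visitList, this]
        simp [hv]
      | succ d =>
        rw [visitList, this]
        have hne : x k ≠ v := by
          rintro rfl
          rw [hT] at hv hn
          exact (List.nodup_cons.1 hn).1 (List.mem_of_getElem? (by simpa using hv))
        simp [hne]
    | false =>
      have hp := H.pop k (by omega) hw
      rw [hp] at hn hv
      cases d with
      | zero =>
        simp only [List.getElem?_cons_zero, Option.some.injEq] at hv
        subst hv
        rw [visitList]
        simp only [decide_true, List.cons.injEq, true_and, List.length_map, List.length_range']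
        rw [List.eq_replicate_iff]
        refine ⟨by simp, ?_⟩
        intro b hb
        obtain ⟨i, hi, rfl⟩ := List.mem_map.1 hb
        rw [List.mem_range'_1] at hi
        have h1 := H.ne_of_notMem (j := k) (k := k + 1) (by omega)
          (List.nodup_cons.1 hn).1 hi.1 (by omega)
        have h2 := H.mem_stack (k := i) (by omega)
        simp only [decide_eq_false_iff_not]
        exact fun h => h1 (h ▸ h2)
      | succ d =>
        rw [visitList, ih (k := k + 1) (d := d) (by omega) (by simpa using hv)]
        have hne : x k ≠ v := by
          rintro rfl
          exact (List.nodup_cons.1 hn).1 (List.mem_of_getElem? (by simpa using hv))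
        simp [hne]

theorem isDyck (H : StackWalk N x w S) {k m d : ℕ} (hkm : k + m = N)
    (hd : (S k).length = d + 1) : IsDyck d ((List.range' k m).map w) := by
  induction m generalizing k d with
  | zero =>
    obtain rfl : k = N := by omega
    rw [H.final] at hd
    simp [IsDyck] at hd ⊢
    exact hd
  | succ m ih =>
    rw [List.range'_succ, List.map_cons]
    cases hw : w k with
    | true =>
      have hp := H.push k (by omega) hw
      cases d <;> exact ih (k := k + 1) (by omega) (by rw [hp]; simp [hd])
    | false =>
      have hp := H.pop k (by omega) hw
      obtain ⟨T, hT⟩ := H.head (k + 1) (by omega)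
      rw [hp, hT] at hd
      simp at hd
      subst hd
      exact ih (k := k + 1) (by omega) (by rw [hT]; simp)

theorem count_visits (H : StackWalk N x w S) {k m : ℕ} (hkm : k + m = N) :
    ((List.range' k (m + 1)).map (fun i => decide (x i = x k))).count true =
      departures 0 ((List.range' k m).map w) + 1 := by
  rw [H.map_visits hkm (d := 0) (H.head_eq (by omega))]
  obtain ⟨T, hT⟩ := H.head k (by omega)
  have := (H.isDyck hkm (d := T.length) (by simp [hT])).count
  exact count_visitList (by omega)

/-- Walks with the same steps have the same coincidences. -/
theorem eq_iff_eq {y : ℕ → ℕ} {S' : ℕ → List ℕ} (H : StackWalk N x w S) (H' : StackWalk N y w S')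
    {j k : ℕ} (hjk : j ≤ k) (hk : k ≤ N) : x j = x k ↔ y j = y k := by
  have h1 := H.map_visits (k := j) (m := N - j) (by omega) (H.head_eq (by omega))
  rw [← H'.map_visits (k := j) (m := N - j) (by omega) (H'.head_eq (by omega))] at h1
  have h2 := congrArg (fun L : List Bool => L[k - j]?) h1
  simp only [List.getElem?_map] at h2
  rw [List.getElem?_range' (by omega)] at h2
  simp only [one_mul, Nat.add_sub_cancel' hjk, Option.map_some, Option.some.injEq,
    decide_eq_decide] at h2
  rw [eq_comm, h2, eq_comm]

end StackWalk

/-! ### From cycles to depth-first walks -/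

/-- The stack of a walk in which a step goes to a new vertex if and only if it traverses an edge
which has been traversed an even number of times. -/
def markStack (x : ℕ → ℕ) : ℕ → List ℕ
  | 0 => [x 0]
  | k + 1 => if walkEdge x k ∈ oddEdges x k then (markStack x k).tail
      else x (k + 1) :: markStack x k

/-- An unmarked step uses an edge of the path to the root that contains its end vertex, hence goes
to the next vertex of the stack; a marked step goes to a fresh vertex by `hf`. The last entry is
tracked in order to identify the stack with `[x 0]` once no odd edge remains. -/
theorem markStack_invariant {N : ℕ} {x : ℕ → ℕ}
    (hf : ∀ k < N, walkEdge x k ∉ oddEdges x k → ∀ j ≤ k, x j ≠ x (k + 1)) {k : ℕ} (hk : k ≤ N) :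
    (∃ T, markStack x k = x k :: T) ∧ (markStack x k).Nodup ∧
      (∀ v ∈ markStack x k, ∃ j ≤ k, x j = v) ∧ oddEdges x k = listEdges (markStack x k) ∧
      (markStack x k).getLast? = some (x 0) := by
  induction k with
  | zero => simp [markStack, oddEdges, listEdges]
  | succ k ih =>
    obtain ⟨⟨T, hT⟩, hn, hs, ho, hl⟩ := ih (by omega)
    by_cases he : walkEdge x k ∈ oddEdges x k
    · rw [markStack, if_pos he]
      have he' := he
      rw [ho, hT] at he'
      rw [hT] at hn
      obtain ⟨T', rfl⟩ := eq_cons_of_mem_listEdges hn he'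
      rw [hT] at ho hl hs ⊢
      refine ⟨⟨T', rfl⟩, (List.nodup_cons.1 hn).2, ?_, (oddEdges_pop hn ho).2, ?_⟩
      · intro v hv
        obtain ⟨j, hj, e⟩ := hs v (List.mem_cons_of_mem _ hv)
        exact ⟨j, by omega, e⟩
      · rwa [List.getLast?_cons_cons] at hl
    · rw [markStack, if_neg he]
      have hnm : x (k + 1) ∉ markStack x k := by
        intro h
        obtain ⟨j, hj, e⟩ := hs _ h
        exact hf k hk he j hj e
      refine ⟨⟨_, rfl⟩, List.nodup_cons.2 ⟨hnm, hn⟩, ?_, ?_, ?_⟩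
      · intro v hv
        rcases List.mem_cons.1 hv with rfl | hv
        · exact ⟨_, le_rfl, rfl⟩
        · obtain ⟨j, hj, e⟩ := hs v hv
          exact ⟨j, by omega, e⟩
      · rw [hT] at hnm ho ⊢
        exact (oddEdges_push hnm ho).2
      · rw [hT] at hl ⊢
        rwa [List.getLast?_cons_cons]

theorem stackWalk_markStack {N : ℕ} {x : ℕ → ℕ}
    (hf : ∀ k < N, walkEdge x k ∉ oddEdges x k → ∀ j ≤ k, x j ≠ x (k + 1))
    (hN : oddEdges x N = ∅) :
    StackWalk N x (fun k => decide (walkEdge x k ∉ oddEdges x k)) (markStack x) where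
  start := rfl
  final := by
    obtain ⟨⟨T, hT⟩, -, -, ho, hl⟩ := markStack_invariant hf le_rfl
    rw [hN] at ho
    rw [hT] at ho hl ⊢
    cases T with
    | nil => simpa using hl
    | cons b T =>
      rw [listEdges] at ho
      exact absurd ho.symm (Finset.insert_ne_empty _ _)
  head k hk := (markStack_invariant hf hk).1
  nodup k hk := (markStack_invariant hf hk).2.1
  seen k hk := (markStack_invariant hf hk).2.2.1
  push k hk hw := by
    rw [markStack, if_neg (by simpa using hw)]
  fresh k hk hw := hf k hk (by simpa using hw)
  pop k hk hw := by
    rw [markStack, if_pos (by simpa using hw)]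
    obtain ⟨T, hT⟩ := (markStack_invariant hf hk.le).1
    rw [hT, List.tail_cons]

/-! ### From Dyck words to depth-first walks -/

/-- The stack and the next label of the walk which explores the tree with contour `w`. -/
def canonicalState (w : ℕ → Bool) : ℕ → List ℕ × ℕ
  | 0 => ([0], 1)
  | k + 1 => if w k then ((canonicalState w k).2 :: (canonicalState w k).1,
      (canonicalState w k).2 + 1) else ((canonicalState w k).1.tail, (canonicalState w k).2)

/-- The rest of the word is a Dyck path from the current height, so a pop never empties the stack;
labels stay below the counter, so a push is always fresh. -/
theorem canonicalState_invariant {N : ℕ} {w : ℕ → Bool}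
    (h : IsDyck 0 ((List.range' 0 N).map w)) {k : ℕ} (hk : k ≤ N) :
    (∃ a T, (canonicalState w k).1 = a :: T ∧
      IsDyck T.length ((List.range' k (N - k)).map w)) ∧
    (canonicalState w k).1.Nodup ∧ (∀ v ∈ (canonicalState w k).1, v < (canonicalState w k).2) ∧
    (canonicalState w k).1.getLast? = some 0 := by
  induction k with
  | zero => simpa [canonicalState] using h
  | succ k ih =>
    obtain ⟨⟨a, T, hT, hd⟩, hn, hb, hl⟩ := ih (by omega)
    rw [show N - k = (N - (k + 1)) + 1 by omega, List.range'_succ, List.map_cons] at hd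
    cases hw : w k with
    | true =>
      rw [canonicalState, if_pos hw]
      refine ⟨⟨_, _, rfl, ?_⟩, ?_, ?_, ?_⟩
      · rw [hw, IsDyck] at hd
        rw [hT]
        exact hd
      · exact List.nodup_cons.2 ⟨fun h => lt_irrefl _ (hb _ h), hn⟩
      · intro v hv
        rcases List.mem_cons.1 hv with rfl | hv
        · exact Nat.lt_succ_self _
        · exact (hb v hv).trans (Nat.lt_succ_self _)
      · rw [hT] at hl ⊢
        rwa [List.getLast?_cons_cons]
    | false =>
      rw [canonicalState, if_neg (by simp [hw])]
      rw [hw] at hd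
      rw [hT] at hn hb hl ⊢
      cases T with
      | nil => exact absurd hd (by simp [IsDyck])
      | cons b T =>
        refine ⟨⟨b, T, rfl, hd⟩, (List.nodup_cons.1 hn).2, ?_, ?_⟩
        · intro v hv
          exact hb v (List.mem_cons_of_mem _ hv)
        · rwa [List.getLast?_cons_cons] at hl

theorem canonicalState_mono (w : ℕ → Bool) : Monotone fun k => (canonicalState w k).2 := by
  refine monotone_nat_of_le_succ fun k => ?_
  rw [canonicalState]
  split_ifs <;> simp

theorem exists_stackWalk {N : ℕ} {w : ℕ → Bool} (h : IsDyck 0 ((List.range' 0 N).map w)) :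
    ∃ x S, StackWalk N x w S := by
  have hx : ∀ k ≤ N, ∃ T, (canonicalState w k).1 = (canonicalState w k).1.headD 0 :: T := by
    intro k hk
    obtain ⟨⟨a, T, hT, -⟩, -⟩ := canonicalState_invariant h hk
    exact ⟨T, by simp [hT]⟩
  have hlt : ∀ k ≤ N, (canonicalState w k).1.headD 0 < (canonicalState w k).2 := by
    intro k hk
    obtain ⟨T, hT⟩ := hx k hk
    refine (canonicalState_invariant h hk).2.2.1 _ ?_
    rw [hT]
    simp
  refine ⟨fun k => (canonicalState w k).1.headD 0, fun k => (canonicalState w k).1, ?_⟩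
  have hpush : ∀ k < N, w k = true → (canonicalState w (k + 1)).1 =
      (canonicalState w (k + 1)).1.headD 0 :: (canonicalState w k).1 := by
    intro k hk hw
    simp [canonicalState, hw]
  refine ⟨rfl, ?_, hx, fun k hk => (canonicalState_invariant h hk).2.1, ?_, hpush, ?_, ?_⟩
  · obtain ⟨⟨a, T, hT, hd⟩, -, -, hl⟩ := canonicalState_invariant h le_rfl
    have : T = [] := by simpa [IsDyck] using hd
    subst this
    rw [hT] at hl ⊢
    simpa [canonicalState] using hl
  · intro k hk
    induction k with
    | zero => simp [canonicalState]
    | succ k ih =>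
      intro v hv
      cases hw : w k with
      | true =>
        rw [hpush k hk hw] at hv
        rcases List.mem_cons.1 hv with rfl | hv
        · exact ⟨k + 1, le_rfl, rfl⟩
        · obtain ⟨j, hj, e⟩ := ih (by omega) v hv
          exact ⟨j, by omega, e⟩
      | false =>
        rw [canonicalState, if_neg (by simp [hw])] at hv
        obtain ⟨j, hj, e⟩ := ih (by omega) v (List.mem_of_mem_tail hv)
        exact ⟨j, by omega, e⟩
  · intro k hk hw j hj
    have h1 := hlt j (by omega)
    have h2 := canonicalState_mono w hj
    simp only at h2
    rw [canonicalState, if_pos hw]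
    simp only [List.headD_cons]
    omega
  · intro k hk hw
    obtain ⟨T, hT⟩ := hx k hk.le
    rw [canonicalState, if_neg (by simp [hw])]
    simp only
    rw [hT]
    simp

/-! ### Finite cycles as restrictions of infinite walks -/

theorem ncard_fin (n : ℕ) (p : ℕ → Prop) [DecidablePred p] :
    Set.ncard {j : Fin n | p j} = ((Finset.range n).filter p).card := by
  rw [← Set.ncard_coe_finset]
  refine Set.ncard_congr (fun j _ => (j : ℕ)) ?_ ?_ ?_
  · intro j hj
    simpa using hj
  · intro j k _ _ h
    exact Fin.ext h
  · intro k hk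
    simp only [Finset.coe_filter, Finset.mem_range, Set.mem_ofPred_eq] at hk
    exact ⟨⟨k, hk.1⟩, hk.2, rfl⟩

/-- The first `2l + 1` vertices of an infinite walk. -/
def restrict (l : ℕ) (x : ℕ → ℕ) : Fin (2 * l + 1) → ℕ := fun k => x k

/-- An infinite walk that extends a given finite one. -/
def extend {l : ℕ} (i : Fin (2 * l + 1) → ℕ) : ℕ → ℕ :=
  fun k => if h : k < 2 * l + 1 then i ⟨k, h⟩ else 0

theorem restrict_extend {l : ℕ} (i : Fin (2 * l + 1) → ℕ) : restrict l (extend i) = i := by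
  funext k
  rw [restrict, extend, dif_pos k.2]

theorem isMarked_restrict {l : ℕ} (x : ℕ → ℕ) (k : Fin (2 * l)) :
    IsMarked (restrict l x) k ↔ walkEdge x k ∉ oddEdges x k := by
  have h : Set.ncard {j : Fin (2 * l) | j < k ∧ edge (restrict l x) j = edge (restrict l x) k} =
      ((Finset.range k).filter (fun j => walkEdge x j = walkEdge x k)).card := by
    refine (ncard_fin (2 * l) (fun j => j < (k : ℕ) ∧ walkEdge x j = walkEdge x k)).trans ?_
    congr 1
    ext j
    have := k.2
    simp only [Finset.mem_filter, Finset.mem_range]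
    constructor
    · exact fun h => h.2
    · exact fun h => ⟨by omega, h⟩
  rw [IsMarked, h, mem_oddEdges, Nat.not_odd_iff_even]

theorem markCount_restrict {l : ℕ} (x : ℕ → ℕ) (v : ℕ) :
    markCount (restrict l x) v = ((Finset.range (2 * l)).filter
      (fun k => walkEdge x k ∉ oddEdges x k ∧ x (k + 1) = v)).card := by
  rw [markCount, ← ncard_fin]
  congr 1
  ext k
  simp only [Set.mem_ofPred_eq, isMarked_restrict]
  rfl

theorem isEvenCycle_restrict {l : ℕ} (x : ℕ → ℕ) :
    IsEvenCycle l (restrict l x) ↔ x (2 * l) = x 0 ∧ oddEdges x (2 * l) = ∅ := by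
  have h : ∀ e, Set.ncard {k : Fin (2 * l) | edge (restrict l x) k = e} =
      ((Finset.range (2 * l)).filter (fun j => walkEdge x j = e)).card := fun e =>
    ncard_fin (2 * l) (fun j => walkEdge x j = e)
  rw [IsEvenCycle]
  refine and_congr Iff.rfl ?_
  rw [Finset.eq_empty_iff_forall_notMem]
  refine forall_congr' fun e => ?_
  rw [h, mem_oddEdges, Nat.not_odd_iff_even]

theorem multiplicity_restrict {l : ℕ} (x : ℕ → ℕ) (v : ℕ) :
    multiplicity (restrict l x) v =
      ((List.range' 0 (2 * l + 1)).map (fun i => decide (x i = v))).count true := by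
  refine (ncard_fin (2 * l + 1) (fun j => x j = v)).trans ?_
  rw [List.count_eq_countP, List.countP_map, ← List.range_eq_range', List.countP_eq_length_filter,
    Finset.card_def, Finset.filter_val, Finset.range_val, Multiset.range, Multiset.filter_coe,
    Multiset.coe_card]
  congr 1
  exact List.filter_congr (by simp)

/-- Every marked step goes to a new vertex. -/
theorem fresh_of_markCount {l : ℕ} {x : ℕ → ℕ} (ho : oddEdges x (2 * l) = ∅)
    (h1 : Set.ncard {v : ℕ | markCount (restrict l x) v = 1} = l)
    (h0 : markCount (restrict l x) (x 0) = 0) (k : ℕ) (hk : k < 2 * l)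
    (hm : walkEdge x k ∉ oddEdges x k) (j : ℕ) (hj : j ≤ k) : x j ≠ x (k + 1) := by
  classical
  intro hjk
  have hcard := card_marked ho
  set A := (Finset.range (2 * l)).filter (fun j => walkEdge x j ∉ oddEdges x j) with hA
  have hmc : ∀ v, markCount (restrict l x) v = (A.filter (fun k => x (k + 1) = v)).card := by
    intro v
    rw [markCount_restrict, hA, Finset.filter_filter]
  -- Pigeonhole: the `l` vertices marked once are among the endpoints of only `l` marked steps, so
  -- every such endpoint is marked exactly once.
  have hsub : {v : ℕ | markCount (restrict l x) v = 1} ⊆ ↑(A.image (fun k => x (k + 1))) := by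
    intro v hv
    rw [Set.mem_ofPred_eq, hmc, Finset.card_eq_one] at hv
    obtain ⟨a, ha⟩ := hv
    have : a ∈ A.filter (fun k => x (k + 1) = v) := by rw [ha]; simp
    rw [Finset.mem_filter] at this
    exact Finset.mem_coe.2 (Finset.mem_image.2 ⟨a, this⟩)
  have heq := Set.eq_of_subset_of_ncard_le hsub (by
    rw [Set.ncard_coe_finset, h1]
    exact Finset.card_image_le.trans hcard.le) (Finset.finite_toSet _)
  have hkA : k ∈ A := by rw [hA, Finset.mem_filter, Finset.mem_range]; exact ⟨hk, hm⟩
  have hone : markCount (restrict l x) (x (k + 1)) = 1 := by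
    have : x (k + 1) ∈ {v : ℕ | markCount (restrict l x) v = 1} := by
      rw [heq]
      exact Finset.mem_coe.2 (Finset.mem_image_of_mem _ hkA)
    exact this
  have hex : ∃ j, x j = x (k + 1) := ⟨j, hjk⟩
  have hfirst := fun m (hm : m < Nat.find hex) => Nat.find_min hex hm
  have hspec := Nat.find_spec hex
  have hle : Nat.find hex ≤ k := (Nat.find_min' hex hjk).trans hj
  rcases hj0 : Nat.find hex with _ | j'
  · rw [hj0] at hspec
    rw [← hspec, h0] at hone
    exact absurd hone (by norm_num)
  · rw [hj0] at hspec hfirst hle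
    -- The step that first reaches a vertex is marked, since an earlier use of its edge would be an
    -- earlier visit. A later marked step `k` to the same vertex would mark it twice.
    have hj'A : j' ∈ A := by
      rw [hA, Finset.mem_filter, Finset.mem_range, mem_oddEdges, Finset.card_eq_zero.2]
      · exact ⟨by omega, by simp⟩
      · rw [Finset.filter_eq_empty_iff]
        intro m hm he
        rw [Finset.mem_range] at hm
        rw [walkEdge, walkEdge, Sym2.eq_iff, hspec] at he
        rcases he with ⟨-, he⟩ | ⟨he, -⟩
        · exact hfirst (m + 1) (by omega) he
        · exact hfirst m (by omega) he
    rw [hmc, Finset.card_eq_one] at hone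
    obtain ⟨a, ha⟩ := hone
    have e1 : k ∈ A.filter (fun m => x (m + 1) = x (k + 1)) := Finset.mem_filter.2 ⟨hkA, rfl⟩
    have e2 : j' ∈ A.filter (fun m => x (m + 1) = x (k + 1)) :=
      Finset.mem_filter.2 ⟨hj'A, hspec⟩
    rw [ha, Finset.mem_singleton] at e1 e2
    omega

theorem stackWalk_extend {l : ℕ} (i : EvenCycle l) :
    StackWalk (2 * l) (extend i.1)
      (fun k => decide (walkEdge (extend i.1) k ∉ oddEdges (extend i.1) k))
      (markStack (extend i.1)) := by
  obtain ⟨i, h1, h2, h3⟩ := i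
  rw [← restrict_extend i] at h1 h2 h3
  have h1 := (isEvenCycle_restrict _).1 h1
  exact stackWalk_markStack (fresh_of_markCount h1.2 h2 h3) h1.2

/-- Converse direction: pushes are exactly the marked steps and their endpoints are distinct and
different from the root. -/
theorem StackWalk.evenCycle {l : ℕ} {x : ℕ → ℕ} {w : ℕ → Bool} {S : ℕ → List ℕ}
    (H : StackWalk (2 * l) x w S) :
    IsEvenCycle l (restrict l x) ∧ Set.ncard {v : ℕ | markCount (restrict l x) v = 1} = l ∧
      markCount (restrict l x) (restrict l x 0) = 0 := by
  classical
  have ho := H.oddEdges_final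
  refine ⟨(isEvenCycle_restrict x).2 ⟨H.closed, ho⟩, ?_, ?_⟩
  · have hcard := card_marked ho
    set A := (Finset.range (2 * l)).filter (fun j => walkEdge x j ∉ oddEdges x j) with hA
    have hmem : ∀ k ∈ A, k < 2 * l ∧ w k = true := by
      intro k hk
      rw [hA, Finset.mem_filter, Finset.mem_range] at hk
      exact ⟨hk.1, (H.marked_iff hk.1).1 hk.2⟩
    have hinj : Set.InjOn (fun k => x (k + 1)) (A : Set ℕ) := by
      have key : ∀ a b, a < b → b ∈ A → x (a + 1) ≠ x (b + 1) := fun a b hab hb =>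
        H.fresh b (hmem b hb).1 (hmem b hb).2 (a + 1) hab
      intro a ha b hb hab
      rcases lt_trichotomy a b with h | h | h
      · exact absurd hab (key a b h hb)
      · exact h
      · exact absurd hab.symm (key b a h ha)
    have heq : {v : ℕ | markCount (restrict l x) v = 1} = ↑(A.image (fun k => x (k + 1))) := by
      ext v
      rw [Set.mem_ofPred_eq, markCount_restrict, ← Finset.filter_filter, Finset.mem_coe,
        Finset.mem_image, Finset.card_eq_one]
      constructor
      · rintro ⟨a, ha⟩
        have : a ∈ A.filter (fun k => x (k + 1) = v) := by rw [ha]; simp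
        rw [Finset.mem_filter] at this
        exact ⟨a, this⟩
      · rintro ⟨a, ha, rfl⟩
        refine ⟨a, ?_⟩
        ext b
        rw [Finset.mem_filter, Finset.mem_singleton]
        constructor
        · rintro ⟨hb, e⟩
          exact hinj hb ha e
        · rintro rfl
          exact ⟨ha, rfl⟩
    rw [heq, Set.ncard_coe_finset, Finset.card_image_of_injOn hinj, hcard]
  · rw [markCount_restrict, Finset.card_eq_zero, Finset.filter_eq_empty_iff]
    rintro k hk ⟨h1, h2⟩
    rw [Finset.mem_range] at hk
    exact H.fresh k hk ((H.marked_iff hk).1 h1) 0 (Nat.zero_le _) h2.symm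

/-! ### Isomorphism classes correspond to Dyck words -/

/-- The word recording which steps of the cycle are marked. -/
def markWord {l : ℕ} (i : EvenCycle l) : List Bool :=
  (List.range' 0 (2 * l)).map
    (fun k => decide (walkEdge (extend i.1) k ∉ oddEdges (extend i.1) k))

theorem length_markWord {l : ℕ} (i : EvenCycle l) : (markWord i).length = 2 * l := by
  simp [markWord]

theorem drop_markWord {l : ℕ} (i : EvenCycle l) (p : ℕ) :
    (markWord i).drop p = (List.range' p (2 * l - p)).map
      (fun k => decide (walkEdge (extend i.1) k ∉ oddEdges (extend i.1) k)) := by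
  rw [markWord, ← List.map_drop, List.drop_range']
  simp

theorem isDyck_markWord {l : ℕ} (i : EvenCycle l) : IsDyck 0 (markWord i) :=
  (stackWalk_extend i).isDyck (by omega) (by simp [markStack])

theorem count_markWord {l : ℕ} (i : EvenCycle l) : (markWord i).count false = l := by
  have h1 := (isDyck_markWord i).count
  have h2 := List.count_true_add_count_false (l := markWord i)
  rw [length_markWord] at h2
  omega

theorem extend_apply {l : ℕ} (i : Fin (2 * l + 1) → ℕ) (k : Fin (2 * l + 1)) :
    extend i k = i k :=
  congrFun (restrict_extend i) k

theorem equiv_of_markWord_eq {l : ℕ} {i j : EvenCycle l} (h : markWord i = markWord j) :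
    i ≈ j := by
  have hw : ∀ k < 2 * l, decide (walkEdge (extend i.1) k ∉ oddEdges (extend i.1) k) =
      decide (walkEdge (extend j.1) k ∉ oddEdges (extend j.1) k) := by
    intro k hk
    have := congrArg (fun L : List Bool => L[k]?) h
    simpa [markWord, hk] using this
  have H := stackWalk_extend i
  -- The two marking functions agree only before time `2 * l`, so the walk of `i` is re-read with
  -- the steps of `j` field by field.
  have H' : StackWalk (2 * l) (extend i.1) _ (markStack (extend i.1)) := { H with
    push := fun k hk h => H.push k hk ((hw k hk).trans h)
    fresh := fun k hk h => H.fresh k hk ((hw k hk).trans h)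
    pop := fun k hk h => H.pop k hk ((hw k hk).trans h) }
  have key : ∀ s t : Fin (2 * l + 1), s ≤ t → (i.1 s = i.1 t ↔ j.1 s = j.1 t) := by
    intro s t hst
    have := H'.eq_iff_eq (stackWalk_extend j) (j := s) (k := t) hst (by omega)
    simpa only [extend_apply] using this
  intro s t
  rcases le_total s t with h | h
  · exact key s t h
  · rw [eq_comm, key t s h, eq_comm]

/-- Whether a step is marked depends only on equalities between undirected edges, hence only on
coincidences of vertices. -/
theorem markWord_eq_of_equiv {l : ℕ} {i j : EvenCycle l} (h : i ≈ j) :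
    markWord i = markWord j := by
  have h' : ∀ a b : ℕ, a < 2 * l + 1 → b < 2 * l + 1 →
      (extend i.1 a = extend i.1 b ↔ extend j.1 a = extend j.1 b) := by
    intro a b ha hb
    have := h ⟨a, ha⟩ ⟨b, hb⟩
    simpa only [← extend_apply] using this
  refine List.map_congr_left fun k hk => ?_
  rw [List.mem_range'_1] at hk
  rw [decide_eq_decide, not_iff_not, mem_oddEdges, mem_oddEdges]
  have : (Finset.range k).filter (fun m => walkEdge (extend i.1) m = walkEdge (extend i.1) k) =
      (Finset.range k).filter (fun m => walkEdge (extend j.1) m = walkEdge (extend j.1) k) := by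
    refine Finset.filter_congr fun m hm => ?_
    rw [Finset.mem_range] at hm
    simp only [walkEdge, Sym2.eq_iff]
    rw [h' m k, h' (m + 1) (k + 1), h' m (k + 1), h' (m + 1) k] <;> omega
  rw [this]

theorem exists_markWord_eq {l : ℕ} {w : List Bool} (hl : w.length = 2 * l) (hw : IsDyck 0 w) :
    ∃ i : EvenCycle l, markWord i = w := by
  have hmap : (List.range' 0 (2 * l)).map (fun k => w.getD k false) = w := by
    refine List.ext_getElem (by simp [hl]) fun k h1 h2 => ?_
    simp [h2]
  obtain ⟨x, S, H⟩ := exists_stackWalk (N := 2 * l) (w := fun k => w.getD k false)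
    (by rw [hmap]; exact hw)
  refine ⟨⟨restrict l x, H.evenCycle⟩, ?_⟩
  conv_rhs => rw [← hmap]
  refine List.map_congr_left fun k hk => ?_
  rw [List.mem_range'_1] at hk
  have h1 := isMarked_restrict (l := l) (extend (restrict l x)) ⟨k, by omega⟩
  rw [restrict_extend, isMarked_restrict] at h1
  have h2 := H.marked_iff (k := k) (by omega)
  simp only at h1 h2
  rw [Bool.eq_iff_iff, decide_eq_true_iff, ← h2, h1]

/-- The word of a class of cycles. -/
noncomputable def classWord {l : ℕ} (c : CycleClass l) : List Bool := markWord (Quotient.out c)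

theorem classWord_injective (l : ℕ) : Function.Injective (classWord (l := l)) := by
  intro c d h
  rw [← Quotient.out_eq c, ← Quotient.out_eq d]
  exact Quotient.sound (equiv_of_markWord_eq h)

theorem exists_classWord_eq {l : ℕ} {w : List Bool} (hl : w.length = 2 * l) (hw : IsDyck 0 w) :
    ∃ c : CycleClass l, classWord c = w := by
  obtain ⟨i, hi⟩ := exists_markWord_eq hl hw
  exact ⟨Quotient.mk _ i, (markWord_eq_of_equiv (Quotient.mk_out i)).trans hi⟩

theorem b_eq_sum (l t : ℕ) : b l t = ∑ c : CycleClass l, vertexCount t (Quotient.out c).1 := by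
  refine Finset.sum_congr rfl fun c _ => ?_
  conv_lhs => rw [← Quotient.out_eq c]
  rfl

/-! ### Multiplicities and the bounds on `b` -/

theorem multiplicity_eq_of_first {l : ℕ} (i : EvenCycle l) {p : ℕ} (hp : p ≤ 2 * l)
    (hfirst : ∀ j < p, extend i.1 j ≠ extend i.1 p) :
    multiplicity i.1 (extend i.1 p) = departures 0 ((markWord i).drop p) + 1 := by
  rw [drop_markWord, ← (stackWalk_extend i).count_visits (k := p) (m := 2 * l - p) (by omega)]
  conv_lhs => rw [← restrict_extend i.1, multiplicity_restrict, restrict_extend]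
  have hr : List.range' 0 (2 * l + 1) = List.range' 0 p ++ List.range' p (2 * l - p + 1) := by
    rw [show 2 * l + 1 = p + (2 * l - p + 1) by omega, ← List.range'_append_1, zero_add]
  rw [hr, List.map_append, List.count_append, List.count_eq_zero_of_not_mem, zero_add]
  simp only [List.mem_map, List.mem_range'_1, decide_eq_true_eq, not_exists, not_and]
  intro j hj
  exact hfirst j (by omega)

/-- Each vertex is charged to the time of its first visit. The right side ignores whether `p` is a
first visit, which costs only a polynomial factor. -/
theorem vertexCount_le {l t : ℕ} (i : EvenCycle l) :
    vertexCount t i.1 ≤ ((Finset.range (2 * l + 1)).filter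
      (fun p => departures 0 ((markWord i).drop p) + 1 = t)).card := by
  refine le_trans ?_ (Finset.card_image_le (f := extend i.1))
  rw [← Set.ncard_coe_finset, vertexCount]
  refine Set.ncard_le_ncard ?_ (Finset.finite_toSet _)
  rintro v ⟨⟨k, rfl⟩, hm⟩
  have hex : ∃ j, extend i.1 j = i.1 k := ⟨k, extend_apply _ _⟩
  have hspec := Nat.find_spec hex
  have hle : Nat.find hex ≤ k := Nat.find_min' hex (extend_apply _ _)
  have h := multiplicity_eq_of_first i (p := Nat.find hex) (by omega)
    (fun j hj => by rw [hspec]; exact Nat.find_min hex hj)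
  rw [hspec, hm] at h
  refine Finset.mem_coe.2 (Finset.mem_image.2 ⟨Nat.find hex, ?_, hspec⟩)
  rw [Finset.mem_filter, Finset.mem_range]
  exact ⟨by omega, h.symm⟩

theorem b_le (l k n : ℕ) (h : 2 * l = k + n) : b l (k + 1) ≤ (2 * l + 1) * n.choose l := by
  classical
  rw [b_eq_sum]
  calc _ ≤ ∑ c : CycleClass l, ((Finset.range (2 * l + 1)).filter
        (fun p => departures 0 ((classWord c).drop p) + 1 = k + 1)).card :=
        Finset.sum_le_sum fun c _ => vertexCount_le _
    _ = ∑ p ∈ Finset.range (2 * l + 1), (Finset.univ.filter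
        (fun c : CycleClass l => departures 0 ((classWord c).drop p) + 1 = k + 1)).card := by
        simp only [Finset.card_filter]
        exact Finset.sum_comm
    _ ≤ ∑ p ∈ Finset.range (2 * l + 1), n.choose l := by
        refine Finset.sum_le_sum fun p _ => ?_
        refine le_trans ?_ (ncard_departures_drop_le p k n l)
        rw [← Finset.card_image_of_injective _ (classWord_injective l), ← Set.ncard_coe_finset]
        refine Set.ncard_le_ncard ?_ (finite_lists _ _)
        intro w hw
        obtain ⟨c, hc, rfl⟩ := Finset.mem_image.1 (Finset.mem_coe.1 hw)
        rw [Finset.mem_filter] at hc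
        exact ⟨(length_markWord _).trans h, count_markWord _, by omega⟩
    _ = _ := by simp

theorem ncard_dyckSet_le_card {l U k : ℕ} (h : l = U + k) (P : CycleClass l → Prop)
    [DecidablePred P] (hP : ∀ c, departures 0 (classWord c) = k → P c) :
    (dyckSet U 0 k).ncard ≤ (Finset.univ.filter P).card := by
  rw [← Finset.card_image_of_injective _ (classWord_injective l), ← Set.ncard_coe_finset]
  refine Set.ncard_le_ncard ?_ (Finset.finite_toSet _)
  rintro w ⟨h1, h2, h3⟩
  obtain ⟨c, rfl⟩ := exists_classWord_eq (l := l) (by omega) h2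
  exact Finset.mem_coe.2 (Finset.mem_image.2
    ⟨c, Finset.mem_filter.2 ⟨Finset.mem_univ _, hP c h3⟩, rfl⟩)

theorem vertexCount_pos {l t : ℕ} (i : EvenCycle l) {p : ℕ} (hp : p ≤ 2 * l)
    (hm : multiplicity i.1 (extend i.1 p) = t) : 0 < vertexCount t i.1 := by
  rw [vertexCount, Set.ncard_pos (Set.finite_range i.1 |>.subset fun v hv => hv.1)]
  refine ⟨extend i.1 p, ⟨⟨p, by omega⟩, ?_⟩, hm⟩
  exact (extend_apply i.1 ⟨p, by omega⟩).symm

theorem card_le_b {l t : ℕ} (P : CycleClass l → Prop) [DecidablePred P]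
    (hP : ∀ c, P c → 0 < vertexCount t (Quotient.out c).1) :
    (Finset.univ.filter P).card ≤ b l t := by
  rw [b_eq_sum, Finset.card_filter]
  refine Finset.sum_le_sum fun c _ => ?_
  split_ifs with h
  · exact hP c h
  · exact Nat.zero_le _

/-- Only the root is counted: its multiplicity is one plus the number of excursions of the whole
word. -/
theorem ncard_dyckSet_le_b (U k : ℕ) : (dyckSet U 0 k).ncard ≤ b (U + k) (k + 1) := by
  classical
  refine (ncard_dyckSet_le_card rfl (fun c => departures 0 (classWord c) = k)
    fun c h => h).trans (card_le_b _ fun c hc => ?_)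
  refine vertexCount_pos _ (p := 0) (Nat.zero_le _) ?_
  rw [multiplicity_eq_of_first _ (Nat.zero_le _) (by simp)]
  simpa [classWord] using hc

/-- Right after the last up-step the walk cannot rise again, so it stands at a leaf. -/
theorem exists_departures_drop_eq_zero (w : List Bool) (hw : true ∈ w) :
    ∃ p ≤ w.length, p ≠ 0 ∧ w[p - 1]? = some true ∧ departures 0 (w.drop p) = 0 := by
  induction w with
  | nil => simp at hw
  | cons a w ih =>
    by_cases h : true ∈ w
    · obtain ⟨p, h1, h2, h3, h4⟩ := ih h
      refine ⟨p + 1, by simpa using h1, by simp, ?_, by simpa using h4⟩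
      obtain ⟨q, rfl⟩ := Nat.exists_eq_succ_of_ne_zero h2
      simpa using h3
    · obtain rfl : true = a := by simpa [h] using hw
      refine ⟨1, by simp, by simp, by simp, ?_⟩
      match w, h with
      | [], _ => simp [departures]
      | false :: w, _ => simp [departures]
      | true :: w, h => simp at h

theorem ncard_dyckSet_le_b_one (U k : ℕ) (h : 1 ≤ U + k) :
    (dyckSet U 0 k).ncard ≤ b (U + k) 1 := by
  classical
  refine (ncard_dyckSet_le_card rfl (fun _ => True) fun c h => trivial).trans
    (card_le_b _ fun c _ => ?_)
  set i := Quotient.out c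
  have hl := length_markWord i
  have hmem : true ∈ markWord i := by
    have h1 := count_markWord i
    have h2 := List.count_true_add_count_false (l := markWord i)
    exact List.count_pos_iff.1 (by omega)
  obtain ⟨p, hp, hp0, hup, hdep⟩ := exists_departures_drop_eq_zero _ hmem
  obtain ⟨q, rfl⟩ := Nat.exists_eq_succ_of_ne_zero hp0
  refine vertexCount_pos i (p := q + 1) (by omega) ?_
  rw [multiplicity_eq_of_first i (by omega), hdep]
  intro j hj
  refine (stackWalk_extend i).fresh q (by omega) ?_ j (by omega)
  rw [Nat.succ_sub_one, markWord, List.getElem?_map, List.getElem?_range' (by omega)] at hup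
  simpa using hup

/-- Rewrites the difference of binomials from the reflection principle as the ballot number `k /
(2U+k) * (2U+k).choose (U+k)`, without division. -/
theorem mul_choose_le_ncard_dyckSet (U k : ℕ) (h : 1 ≤ k) :
    k * (2 * U + k).choose (U + k) ≤ (2 * U + k) * (dyckSet U 0 k).ncard := by
  obtain ⟨k, rfl⟩ : ∃ m, k = m + 1 := ⟨k - 1, by omega⟩
  have h1 := choose_le_ncard_dyckSet U 0 (k + 1) (2 * U + k) (by ring)
  have h2 := Nat.add_one_mul_choose_eq (2 * U + k) (U + k)
  have h3 := Nat.choose_symm_of_eq_add (n := 2 * U + k + 1) (a := U) (b := U + (k + 1)) (by ring)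
  have h4 := Nat.choose_symm_of_eq_add (n := 2 * U + k) (a := U) (b := U + k) (by ring)
  rw [add_zero] at h1
  have h5 : (2 * U + k + 1) * (2 * U + k).choose (U + (k + 1)) =
      U * (2 * U + k + 1).choose (U + (k + 1)) := by
    rcases U with _ | U
    · rw [Nat.choose_eq_zero_of_lt (by omega)]; simp
    · have := Nat.add_one_mul_choose_eq (2 * (U + 1) + k) U
      rw [← h3, mul_comm (U + 1), ← this]
      congr 1
      exact (Nat.choose_symm_of_eq_add (by ring)).symm
  rw [h4] at h1
  have h6 := Nat.mul_le_mul_left (2 * U + k + 1) h1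
  rw [mul_add, h2, h5] at h6
  rw [show 2 * U + (k + 1) = 2 * U + k + 1 by ring]
  rw [show U + k + 1 = U + (k + 1) by ring] at h6
  nlinarith

theorem le_b (l t : ℕ) (hl : 1 ≤ l) (ht : 1 ≤ t) (htl : t ≤ l + 1) :
    (2 * l + 1 - t).choose l ≤ 4 * l * b l t := by
  rcases Nat.lt_or_ge 1 t with h | h
  · obtain ⟨k, rfl⟩ : ∃ k, t = k + 1 := ⟨t - 1, by omega⟩
    obtain ⟨U, rfl⟩ : ∃ U, l = U + k := ⟨l - k, by omega⟩
    have h1 := mul_choose_le_ncard_dyckSet U k (by omega)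
    have h2 := ncard_dyckSet_le_b U k
    rw [show 2 * (U + k) + 1 - (k + 1) = 2 * U + k by omega]
    calc _ ≤ k * (2 * U + k).choose (U + k) := Nat.le_mul_of_pos_left _ (by omega)
      _ ≤ _ := h1
      _ ≤ (4 * (U + k)) * b (U + k) (k + 1) := Nat.mul_le_mul (by omega) h2
  -- The root cannot serve for `t = 1`, as it recurs when `l ≥ 1`. Every tree has a leaf, and the
  -- trees whose root has one child are already numerous enough: `(2U+2).choose (U+1)` is twice
  -- `(2U+1).choose U`.
  · obtain rfl : t = 1 := by omega
    obtain ⟨U, rfl⟩ : ∃ U, l = U + 1 := ⟨l - 1, by omega⟩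
    have h1 := mul_choose_le_ncard_dyckSet U 1 le_rfl
    have h2 := ncard_dyckSet_le_b_one U 1 (by omega)
    have h3 := Nat.choose_symm_half U
    rw [show 2 * (U + 1) + 1 - 1 = 2 * U + 1 + 1 by omega, Nat.choose_succ_succ', ← h3]
    have h4 := Nat.mul_le_mul_left (4 * U + 2) h2
    nlinarith

theorem b_bounds (l t : ℕ) (hl : 1 ≤ l) (ht : 1 ≤ t) (htl : t ≤ l + 1) :
    1 / (4 * (l : ℝ)) * ((2 * l + 1 - t).choose l : ℝ) ≤ (b l t : ℝ) ∧
      (b l t : ℝ) ≤ ((l : ℝ) + 1) ^ 120 * ((2 * l + 1 - t).choose l : ℝ) := by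
  have hl' : (1 : ℝ) ≤ l := by exact_mod_cast hl
  constructor
  · rw [one_div, inv_mul_le_iff₀ (by positivity)]
    exact_mod_cast le_b l t hl ht htl
  · have h1 := b_le l (t - 1) (2 * l + 1 - t) (by omega)
    rw [Nat.sub_add_cancel ht] at h1
    have h2 : (b l t : ℝ) ≤ (2 * l + 1) * ((2 * l + 1 - t).choose l : ℝ) := by exact_mod_cast h1
    refine h2.trans (mul_le_mul_of_nonneg_right ?_ (Nat.cast_nonneg _))
    -- The exponent `120` is far from needed: the counting gives the factor `2l+1`.
    calc 2 * (l : ℝ) + 1 ≤ (l + 1) ^ 2 := by nlinarith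
      _ ≤ (l + 1) ^ 120 := pow_le_pow_right₀ (by linarith) (by norm_num)

/-! ### Entropy inequalities and the supremum of `h` -/

theorem rpow_self_pos {a : ℝ} (ha : 0 ≤ a) : 0 < a ^ a := by
  rcases ha.eq_or_lt with rfl | h
  · simp
  · exact Real.rpow_pos_of_pos h a

/-- One factor of Gibbs' inequality, from `u ≤ exp (u - 1)` at `u = t r / a`. When the factors are
multiplied, the exponentials cancel because the weights sum to one. -/
theorem mul_rpow_le_rpow_self_mul_exp {a r t : ℝ} (ha : 0 ≤ a) (hr : 0 < r) (ht : 0 ≤ t) :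
    t ^ a * r ^ a ≤ a ^ a * Real.exp (r * t - a) := by
  rcases ha.eq_or_lt with rfl | h
  · simp only [Real.rpow_zero, mul_one, sub_zero, one_mul]
    exact Real.one_le_exp (by positivity)
  · have h1 : (t * r / a) ^ a ≤ Real.exp (r * t - a) := by
      calc (t * r / a) ^ a ≤ Real.exp (t * r / a - 1) ^ a := by
            refine Real.rpow_le_rpow (by positivity) ?_ ha
            have := Real.add_one_le_exp (t * r / a - 1)
            linarith
        _ = _ := by
            rw [← Real.exp_mul]
            congr 1
            field_simp
    calc t ^ a * r ^ a = a ^ a * (t * r / a) ^ a := by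
          rw [← Real.mul_rpow ht hr.le, ← Real.mul_rpow ha (by positivity)]
          congr 1
          field_simp
      _ ≤ _ := mul_le_mul_of_nonneg_left h1 (rpow_self_pos ha).le

theorem multinomial_entropy₂ {a b r s : ℝ} (ha : 0 ≤ a) (hb : 0 ≤ b) (hr : 0 < r) (hs : 0 < s)
    (h : r + s = 1) : (a + b) ^ (a + b) * (r ^ a * s ^ b) ≤ a ^ a * b ^ b := by
  have ht : 0 ≤ a + b := by positivity
  have h1 := mul_rpow_le_rpow_self_mul_exp ha hr ht
  have h2 := mul_rpow_le_rpow_self_mul_exp hb hs ht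
  calc (a + b) ^ (a + b) * (r ^ a * s ^ b)
      = ((a + b) ^ a * r ^ a) * ((a + b) ^ b * s ^ b) := by
        rw [Real.rpow_add_of_nonneg ht ha hb]; ring
    _ ≤ (a ^ a * Real.exp (r * (a + b) - a)) * (b ^ b * Real.exp (s * (a + b) - b)) := by
        gcongr
    _ = a ^ a * b ^ b * Real.exp ((r + s - 1) * (a + b)) := by
        rw [show (r + s - 1) * (a + b) = (r * (a + b) - a) + (s * (a + b) - b) by ring,
          Real.exp_add]
        ring
    _ = _ := by rw [h]; simp

theorem multinomial_entropy₃ {a b c r s u : ℝ} (ha : 0 ≤ a) (hb : 0 ≤ b) (hc : 0 ≤ c)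
    (hr : 0 < r) (hs : 0 < s) (hu : 0 < u) (h : r + s + u = 1) :
    (a + b + c) ^ (a + b + c) * (r ^ a * s ^ b * u ^ c) ≤ a ^ a * b ^ b * c ^ c := by
  have ht : 0 ≤ a + b + c := by positivity
  have h1 := mul_rpow_le_rpow_self_mul_exp ha hr ht
  have h2 := mul_rpow_le_rpow_self_mul_exp hb hs ht
  have h3 := mul_rpow_le_rpow_self_mul_exp hc hu ht
  calc (a + b + c) ^ (a + b + c) * (r ^ a * s ^ b * u ^ c)
      = ((a + b + c) ^ a * r ^ a) * ((a + b + c) ^ b * s ^ b) * ((a + b + c) ^ c * u ^ c) := by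
        rw [Real.rpow_add_of_nonneg ht (add_nonneg ha hb) hc, Real.rpow_add_of_nonneg ht ha hb]
        ring
    _ ≤ (a ^ a * Real.exp (r * (a + b + c) - a)) * (b ^ b * Real.exp (s * (a + b + c) - b)) *
        (c ^ c * Real.exp (u * (a + b + c) - c)) := by
        gcongr
    _ = a ^ a * b ^ b * c ^ c * Real.exp ((r + s + u - 1) * (a + b + c)) := by
        rw [show (r + s + u - 1) * (a + b + c) = (r * (a + b + c) - a) + (s * (a + b + c) - b) +
          (u * (a + b + c) - c) by ring, Real.exp_add, Real.exp_add]
        ring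
    _ = _ := by rw [h]; simp

theorem multinomial_entropy₂_eq {a b t r s : ℝ} (ht : 0 ≤ t) (hr : 0 < r) (hs : 0 < s)
    (h : r + s = 1) (ha : a = r * t) (hb : b = s * t) :
    t ^ t * (r ^ a * s ^ b) = a ^ a * b ^ b := by
  have h1 : a ^ a = r ^ a * t ^ a := by rw [← Real.mul_rpow hr.le ht, ← ha]
  have h2 : b ^ b = s ^ b * t ^ b := by rw [← Real.mul_rpow hs.le ht, ← hb]
  have h3 : t ^ t = t ^ a * t ^ b := by
    rw [← Real.rpow_add_of_nonneg ht (by rw [ha]; positivity) (by rw [hb]; positivity), ha, hb,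
      ← add_mul, h, one_mul]
  rw [h1, h2, h3]
  ring

theorem multinomial_entropy₃_eq {a b c t r s u : ℝ} (ht : 0 ≤ t) (hr : 0 < r) (hs : 0 < s)
    (hu : 0 < u) (h : r + s + u = 1) (ha : a = r * t) (hb : b = s * t) (hc : c = u * t) :
    t ^ t * (r ^ a * s ^ b * u ^ c) = a ^ a * b ^ b * c ^ c := by
  have h1 : a ^ a = r ^ a * t ^ a := by rw [← Real.mul_rpow hr.le ht, ← ha]
  have h2 : b ^ b = s ^ b * t ^ b := by rw [← Real.mul_rpow hs.le ht, ← hb]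
  have h4 : c ^ c = u ^ c * t ^ c := by rw [← Real.mul_rpow hu.le ht, ← hc]
  have h3 : t ^ t = t ^ a * t ^ b * t ^ c := by
    rw [← Real.rpow_add_of_nonneg ht (by rw [ha]; positivity) (by rw [hb]; positivity),
      ← Real.rpow_add_of_nonneg ht (by rw [ha, hb]; positivity) (by rw [hc]; positivity),
      ha, hb, hc, ← add_mul, ← add_mul, h, one_mul]
  rw [h1, h2, h3, h4]
  ring

/-- The product of the extremal weights. -/
theorem weights_mul {M : ℝ} (hM : 0 < M) (x y z : ℝ) :
    M ^ (2 * x) = (M ^ 2 + 1) ^ 2 / M ^ 2 *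
      (((M ^ 4 / (M ^ 2 + 1) ^ 2) ^ (x - y) * (M ^ 2 / (M ^ 2 + 1) ^ 2) ^ (2 * y) *
        (1 / (M ^ 2 + 1)) ^ (z - 2 * y)) *
      ((M ^ 2 / (M ^ 2 + 1)) ^ (1 - x) * (1 / (M ^ 2 + 1)) ^ (1 - x - z))) := by
  obtain ⟨m, rfl⟩ : ∃ m, M = Real.exp m := ⟨_, (Real.exp_log hM).symm⟩
  obtain ⟨c, hc⟩ : ∃ c, Real.exp m ^ 2 + 1 = Real.exp c :=
    ⟨_, (Real.exp_log (by positivity)).symm⟩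
  rw [hc]
  simp only [← Real.exp_nat_mul, one_div, ← Real.exp_neg, ← Real.exp_sub, ← Real.exp_mul,
    ← Real.exp_add]
  congr 1
  push_cast
  ring

theorem h_le {M : ℝ} (hM : 0 < M) {w : ℝ × ℝ × ℝ} (hw : w ∈ D) :
    h M w ≤ (M ^ 2 + 1) ^ 2 / M ^ 2 := by
  obtain ⟨x, y, z⟩ := w
  obtain ⟨hx0, hx1, hz0, hz1, hy0, hy⟩ := hw
  simp only [le_min_iff] at hx0 hx1 hz0 hz1 hy0 hy
  have e1 := multinomial_entropy₃ (a := x - y) (b := 2 * y) (c := z - 2 * y)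
    (r := M ^ 4 / (M ^ 2 + 1) ^ 2) (s := M ^ 2 / (M ^ 2 + 1) ^ 2) (u := 1 / (M ^ 2 + 1))
    (by linarith) (by linarith) (by linarith) (by positivity) (by positivity) (by positivity)
    (by field_simp)
  have e2 := multinomial_entropy₂ (a := 1 - x) (b := 1 - x - z) (r := M ^ 2 / (M ^ 2 + 1))
    (s := 1 / (M ^ 2 + 1)) (by linarith) (by linarith) (by positivity) (by positivity)
    (by field_simp)
  rw [show x - y + 2 * y + (z - 2 * y) = x - y + z by ring] at e1
  rw [show 1 - x + (1 - x - z) = 2 - 2 * x - z by ring] at e2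
  have p1 := rpow_self_pos (a := x - y) (by linarith)
  have p2 := rpow_self_pos (a := 2 * y) (by linarith)
  have p3 := rpow_self_pos (a := z - 2 * y) (by linarith)
  have p4 := rpow_self_pos (a := 1 - x) (by linarith)
  have p5 := rpow_self_pos (a := 1 - x - z) (by linarith)
  have p6 := rpow_self_pos (a := x - y + z) (by linarith)
  have p7 := rpow_self_pos (a := 2 - 2 * x - z) (by linarith)
  simp only [h]
  rw [weights_mul hM x y z, mul_assoc, mul_assoc]
  refine mul_le_of_le_one_right (by positivity) ?_
  set W₁ := (M ^ 4 / (M ^ 2 + 1) ^ 2) ^ (x - y) * (M ^ 2 / (M ^ 2 + 1) ^ 2) ^ (2 * y) *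
        (1 / (M ^ 2 + 1)) ^ (z - 2 * y) with hW₁
  set W₂ := (M ^ 2 / (M ^ 2 + 1)) ^ (1 - x) * (1 / (M ^ 2 + 1)) ^ (1 - x - z) with hW₂
  have q1 : 0 < W₁ := by positivity
  have q2 : 0 < W₂ := by positivity
  rw [div_mul_div_comm, ← mul_div_assoc, div_le_one (by positivity)]
  calc _ = ((x - y + z) ^ (x - y + z) * W₁) * ((2 - 2 * x - z) ^ (2 - 2 * x - z) * W₂) := by ring
    _ ≤ _ := mul_le_mul e1 e2 (by positivity) (by positivity)

theorem exists_h_eq {M : ℝ} (hM : 1 ≤ M) :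
    ∃ w ∈ D, h M w = (M ^ 2 + 1) ^ 2 / M ^ 2 := by
  have hM0 : 0 < M := by linarith
  set q := M ^ 2 with hq
  have hq1 : 1 ≤ q := one_le_pow₀ hM
  have hq0 : 0 < q := by linarith
  have hq2 : 0 ≤ q - 1 := by linarith
  -- The solution of `(1-x) : (1-x-z) = q : 1` and `(x-y) : 2y : (z-2y) = q² : q : (q+1)`, the
  -- proportions of equality. It has `x ≥ 0` because `q ≥ 1`.
  set x := (q - 1) / (q + 1) with hx
  set y := (q - 1) / ((q + 1) * (2 * q + 1)) with hy
  set z := 2 * (q - 1) / (q * (q + 1)) with hz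
  have hM4 : M ^ 4 = q ^ 2 := by rw [hq]; ring
  have a0 : x - y + z = 2 * (q - 1) * (q + 1) / (q * (2 * q + 1)) := by
    rw [hx, hy, hz]; field_simp; ring
  have a1 : x - y = M ^ 4 / (q + 1) ^ 2 * (x - y + z) := by
    rw [a0, hM4, hx, hy]; field_simp; ring
  have a2 : 2 * y = q / (q + 1) ^ 2 * (x - y + z) := by
    rw [a0, hy]; field_simp
  have a3 : z - 2 * y = 1 / (q + 1) * (x - y + z) := by
    rw [a0, hy, hz]; field_simp; ring
  have b0 : 2 - 2 * x - z = 2 / q := by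
    rw [hx, hz]; field_simp; ring
  have b1 : 1 - x = q / (q + 1) * (2 - 2 * x - z) := by
    rw [b0, hx]; field_simp; ring
  have b2 : 1 - x - z = 1 / (q + 1) * (2 - 2 * x - z) := by
    rw [b0, hx, hz]; field_simp; ring
  have t0 : 0 ≤ x - y + z := by rw [a0]; positivity
  have g0 : 0 ≤ 2 - 2 * x - z := by rw [b0]; positivity
  have n1 : 0 ≤ x - y := by rw [a1]; positivity
  have n3 : 0 ≤ z - 2 * y := by rw [a3]; positivity
  have n4 : 0 ≤ 1 - x := by rw [b1]; positivity
  have n5 : 0 ≤ 1 - x - z := by rw [b2]; positivity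
  have x0 : 0 ≤ x := by rw [hx]; positivity
  have y0 : 0 ≤ y := by rw [hy]; positivity
  have z0 : 0 ≤ z := by rw [hz]; positivity
  refine ⟨(x, y, z), ⟨x0, by simp only; linarith, z0, by simp only; linarith, y0,
    le_min (by simp only; linarith) (by simp only; linarith)⟩, ?_⟩
  have e1 := multinomial_entropy₃_eq t0 (by positivity) (by positivity) (by positivity)
    (by rw [hM4]; field_simp) a1 a2 a3
  have e2 := multinomial_entropy₂_eq g0 (by positivity) (by positivity)
    (by field_simp) b1 b2
  have p1 := rpow_self_pos n1
  have p2 := rpow_self_pos (a := 2 * y) (by linarith)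
  have p3 := rpow_self_pos n3
  have p4 := rpow_self_pos n4
  have p5 := rpow_self_pos n5
  simp only [h]
  rw [weights_mul hM0 x y z, ← hq, mul_assoc, mul_assoc]
  refine (congrArg _ ?_).trans (mul_one _)
  rw [div_mul_div_comm, ← mul_div_assoc, div_eq_one_iff_eq (by positivity), ← e1, ← e2]
  ring

theorem isLUB_h {M : ℝ} (hM : 0 < M) :
    IsLUB (h M '' D) (if M ≤ 1 then 4 else (M ^ 2 + 1) ^ 2 / M ^ 2) := by
  split_ifs with h1
  · refine IsGreatest.isLUB ⟨⟨(0, 0, 0), by simp [D], by norm_num [h]⟩, ?_⟩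
    rintro _ ⟨⟨x, y, z⟩, hw, rfl⟩
    -- Since `M ^ (2 * x) ≤ 1`, the value is at most that for `M = 1`, which is at most `4`.
    have h2 := h_le one_pos hw
    norm_num at h2
    refine le_trans ?_ h2
    obtain ⟨hx0, hx1, hz0, hz1, hy0, hy⟩ := hw
    simp only [le_min_iff] at hx0 hx1 hz0 hz1 hy0 hy
    simp only [h, Real.one_rpow]
    have p1 := rpow_self_pos (a := x - y) (by linarith)
    have p2 := rpow_self_pos (a := 2 * y) (by linarith)
    have p3 := rpow_self_pos (a := z - 2 * y) (by linarith)
    have p4 := rpow_self_pos (a := 1 - x) (by linarith)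
    have p5 := rpow_self_pos (a := 1 - x - z) (by linarith)
    have p6 := rpow_self_pos (a := x - y + z) (by linarith)
    have p7 := rpow_self_pos (a := 2 - 2 * x - z) (by linarith)
    have := Real.rpow_le_one hM.le h1 (z := 2 * x) (by linarith)
    gcongr
  · obtain ⟨w, hw, e⟩ := exists_h_eq (le_of_not_ge h1)
    refine IsGreatest.isLUB ⟨⟨w, hw, e⟩, ?_⟩
    rintro _ ⟨v, hv, rfl⟩
    exact h_le hM hv

/-! ### Binomial identities from generating functions -/

section Identities

open PowerSeries

theorem mk_one_eq_mul_expand :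
    (mk 1 : ℤ⟦X⟧) = (1 + X) * expand 2 two_ne_zero (mk 1 : ℤ⟦X⟧) := by
  have h1 : (mk 1 : ℤ⟦X⟧) * (1 - X) = 1 := mk_one_mul_one_sub_eq_one ℤ
  have h2 : expand 2 two_ne_zero (mk 1 : ℤ⟦X⟧) * (1 - X ^ 2) = 1 := by
    have := congrArg (expand 2 two_ne_zero) h1
    simpa using this
  calc (mk 1 : ℤ⟦X⟧) = mk 1 * (expand 2 two_ne_zero (mk 1 : ℤ⟦X⟧) * (1 - X ^ 2)) := by
        rw [h2, mul_one]
    _ = (mk 1 * (1 - X)) * ((1 + X) * expand 2 two_ne_zero (mk 1 : ℤ⟦X⟧)) := by ring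
    _ = _ := by rw [h1, one_mul]

theorem coeff_one_add_X_pow_powerSeries (t n : ℕ) :
    coeff n ((1 + X : ℤ⟦X⟧) ^ t) = t.choose n := by
  rw [← Polynomial.coeff_one_add_X_pow ℤ t n, ← Polynomial.coeff_coe]
  simp

/-- The coefficient of `X^{2l}` in `(1-X)^{-(d+1)} = (1+X)^{d+1} (1-X²)^{-(d+1)}`. -/
theorem sum_even_choose_mul_choose (l d : ℕ) :
    ∑ m ∈ Finset.range (l + 1), (d + (l - m)).choose d * (d + 1).choose (2 * m) =
      (d + 2 * l).choose d := by
  have h : (mk 1 : ℤ⟦X⟧) ^ (d + 1) =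
      (1 + X) ^ (d + 1) * expand 2 two_ne_zero ((mk 1 : ℤ⟦X⟧) ^ (d + 1)) := by
    rw [map_pow, ← mul_pow, ← mk_one_eq_mul_expand]
  have h := congrArg (coeff (2 * l)) h
  rw [mk_one_pow_eq_mk_choose_add, coeff_mk, coeff_mul,
    Finset.Nat.sum_antidiagonal_eq_sum_range_succ_mk] at h
  simp only [coeff_one_add_X_pow_powerSeries] at h
  -- The second factor is a series in `X²`, so only even `k = 2m` contribute.
  have himg : ∑ m ∈ Finset.range (l + 1), ((d + 1).choose (2 * m) : ℤ) *
      coeff (2 * l - 2 * m) (expand 2 two_ne_zero (mk fun n => ((d + n).choose d : ℤ))) =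
      ∑ k ∈ Finset.range (2 * l).succ, ((d + 1).choose k : ℤ) *
      coeff (2 * l - k) (expand 2 two_ne_zero (mk fun n => ((d + n).choose d : ℤ))) := by
    rw [← Finset.sum_image (s := Finset.range (l + 1)) (g := fun m => 2 * m)
      (f := fun k => ((d + 1).choose k : ℤ) *
      coeff (2 * l - k) (expand 2 two_ne_zero (mk fun n => ((d + n).choose d : ℤ))))
      (fun a _ b _ hab => by simpa using hab)]
    refine Finset.sum_subset ?_ ?_
    · intro k hk
      obtain ⟨m, hm, rfl⟩ := Finset.mem_image.1 hk
      rw [Finset.mem_range] at hm ⊢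
      omega
    · intro k hk hk'
      rw [coeff_expand_of_not_dvd, mul_zero]
      rintro ⟨c, hc⟩
      rw [Finset.mem_range] at hk
      exact hk' (Finset.mem_image.2 ⟨l - c, Finset.mem_range.2 (by omega), by omega⟩)
  rw [← himg] at h
  have : ((∑ m ∈ Finset.range (l + 1), (d + (l - m)).choose d * (d + 1).choose (2 * m) : ℕ) : ℤ) =
      ((d + 2 * l).choose d : ℕ) := by
    rw [h]
    push_cast
    refine Finset.sum_congr rfl fun m _ => ?_
    rw [← Nat.mul_sub, coeff_expand_mul, coeff_mk, mul_comm]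
  exact_mod_cast this

/-- The coefficient of `X^n` in `(1-X)^{-(a+1)} (1-X)^{-(b+1)}`. -/
theorem sum_choose_mul_choose (a b n : ℕ) :
    ∑ i ∈ Finset.range (n + 1), (a + i).choose a * (b + (n - i)).choose b =
      (a + b + 1 + n).choose (a + b + 1) := by
  have h : (mk 1 : ℤ⟦X⟧) ^ (a + 1) * (mk 1 : ℤ⟦X⟧) ^ (b + 1) = (mk 1 : ℤ⟦X⟧) ^ (a + b + 1 + 1) := by
    rw [← pow_add]
    congr 1
    ring
  have h := congrArg (coeff n) h
  rw [mk_one_pow_eq_mk_choose_add, mk_one_pow_eq_mk_choose_add, mk_one_pow_eq_mk_choose_add,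
    coeff_mk, coeff_mul, Finset.Nat.sum_antidiagonal_eq_sum_range_succ_mk] at h
  simp only [coeff_mk] at h
  exact_mod_cast h

end Identities

theorem sum_filter_choose_mul_choose (l t : ℕ) (ht : 1 ≤ t) :
    ∑ m ∈ Finset.range (l + 1) with 2 * m ≤ t, (l - m + t - 1).choose (l - m) * t.choose (2 * m) =
      (2 * l + (t - 1)).choose (2 * l) := by
  obtain ⟨d, rfl⟩ : ∃ d, t = d + 1 := ⟨t - 1, by omega⟩
  rw [Finset.sum_filter_of_ne, Nat.add_sub_cancel,
    Nat.choose_symm_of_eq_add (show 2 * l + d = 2 * l + d from rfl), add_comm (2 * l),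
    ← sum_even_choose_mul_choose]
  · refine Finset.sum_congr rfl fun m _ => ?_
    rw [← add_assoc, Nat.add_sub_cancel, Nat.choose_symm_add, add_comm]
  · intro m _ h
    by_contra h'
    exact h (by rw [Nat.choose_eq_zero_of_lt (show d + 1 < 2 * m by omega), mul_zero])

theorem sum_choose_eq (p l : ℕ) (hl : l ≤ p) :
    ∑ t ∈ Finset.Icc 1 (p - l + 1), (2 * l + (t - 1)).choose (2 * l) *
      (2 * (p - l) + 1 - t).choose (p - l) = (2 * p + 1).choose (p + l + 1) := by
  have h := sum_choose_mul_choose (2 * l) (p - l) (p - l)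
  rw [show 2 * l + (p - l) + 1 + (p - l) = 2 * p + 1 by omega,
    show 2 * l + (p - l) + 1 = p + l + 1 by omega] at h
  rw [← h, Finset.range_eq_Ico, Finset.sum_Ico_eq_sum_range, ← Finset.Ico_add_one_right_eq_Icc,
    Finset.sum_Ico_eq_sum_range]
  refine Finset.sum_congr (by simp) fun i hi => ?_
  rw [Finset.mem_range] at hi
  congr 2 <;> omega

/-! ### Comparison of `s` and `s'` with a binomial sum -/

/-- The sum to which `s` and `s'` are compared. -/
noncomputable def comparisonSum (p : ℕ) (M : ℝ) : ℝ :=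
  ∑ l ∈ Finset.Icc 1 (p - 1), M ^ (2 * l) * ((2 * p + 1).choose (p + l + 1) : ℝ)

theorem inner_sum_eq (p l t : ℕ) (ht : 1 ≤ t) :
    ∑ l₀ ∈ Finset.range (l + 1) with 2 * l₀ ≤ t,
      (((l - l₀ + t - 1).choose (l - l₀) * t.choose (2 * l₀) * b (p - l) t : ℕ) : ℝ) =
    ((2 * l + (t - 1)).choose (2 * l) : ℝ) * b (p - l) t := by
  rw [← sum_filter_choose_mul_choose l t ht]
  push_cast
  rw [Finset.sum_mul]

theorem s_le (p : ℕ) (M : ℝ) (hM : 0 < M) :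
    s p M ≤ ((p : ℝ) + 1) ^ 120 * comparisonSum p M := by
  rw [s, comparisonSum, Finset.mul_sum]
  refine Finset.sum_le_sum fun l hl => ?_
  rw [Finset.mem_Icc] at hl
  rw [mul_left_comm]
  refine mul_le_mul_of_nonneg_left ?_ (by positivity)
  rw [← sum_choose_eq p l (by omega)]
  rw [Nat.cast_sum, Finset.mul_sum]
  refine Finset.sum_le_sum fun t ht => ?_
  rw [Finset.mem_Icc] at ht
  rw [inner_sum_eq p l t ht.1, Nat.cast_mul, mul_left_comm]
  refine mul_le_mul_of_nonneg_left ?_ (Nat.cast_nonneg _)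
  refine (b_bounds (p - l) t (by omega) ht.1 ht.2).2.trans ?_
  refine mul_le_mul_of_nonneg_right ?_ (Nat.cast_nonneg _)
  have : ((p - l : ℕ) : ℝ) ≤ p := by exact_mod_cast Nat.sub_le _ _
  gcongr

theorem comparisonSum_le (p : ℕ) (M : ℝ) (hM : 0 < M) :
    comparisonSum p M ≤ 4 * p * s p M := by
  rw [s, comparisonSum, Finset.mul_sum]
  refine Finset.sum_le_sum fun l hl => ?_
  rw [Finset.mem_Icc] at hl
  rw [mul_left_comm]
  refine mul_le_mul_of_nonneg_left ?_ (by positivity)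
  rw [← sum_choose_eq p l (by omega)]
  rw [Nat.cast_sum, Finset.mul_sum]
  refine Finset.sum_le_sum fun t ht => ?_
  rw [Finset.mem_Icc] at ht
  rw [inner_sum_eq p l t ht.1, Nat.cast_mul, mul_left_comm]
  refine mul_le_mul_of_nonneg_left ?_ (Nat.cast_nonneg _)
  have h1 := le_b (p - l) t (by omega) ht.1 ht.2
  have h2 : (2 * (p - l) + 1 - t).choose (p - l) ≤ 4 * p * b (p - l) t :=
    h1.trans (Nat.mul_le_mul_right _ (by omega))
  exact_mod_cast h2

theorem s'_le_s (p : ℕ) (M : ℝ) (hM : 0 < M) : s' p M ≤ s p M := by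
  refine Finset.sum_le_sum fun l _ => mul_le_mul_of_nonneg_left ?_ (by positivity)
  refine Finset.sum_le_sum fun t _ => Finset.sum_le_sum_of_subset_of_nonneg ?_ ?_
  · intro m hm
    rw [Finset.mem_filter] at hm ⊢
    exact ⟨hm.1, by omega⟩
  · intro m _ _
    positivity

/-- The last term of the inner sum of `s` is at most the preceding one. -/
theorem last_term_le (l m : ℕ) (hm : m + 1 ≤ l) :
    (l - (m + 1) + 2 * (m + 1) - 1).choose (l - (m + 1)) * (2 * (m + 1)).choose (2 * (m + 1)) ≤
      (l - m + 2 * (m + 1) - 1).choose (l - m) * (2 * (m + 1)).choose (2 * m) := by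
  refine Nat.mul_le_mul ?_ ?_
  · rw [show l - m + 2 * (m + 1) - 1 = (l - (m + 1) + 2 * (m + 1) - 1) + 1 by omega,
      show l - m = l - (m + 1) + 1 by omega, Nat.choose_succ_succ']
    exact Nat.le_add_right _ _
  · rw [Nat.choose_self]
    exact Nat.choose_pos (by omega)

/-- The sums differ only in the terms `t = 2 l₀`. Each is at most the term for `l₀ - 1`, which
exists since `t ≥ 1` and belongs to `s'`. -/
theorem s_le_two_mul_s' (p : ℕ) (M : ℝ) (hM : 0 < M) : s p M ≤ 2 * s' p M := by
  rw [s, s', Finset.mul_sum]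
  refine Finset.sum_le_sum fun l _ => ?_
  rw [mul_left_comm]
  refine mul_le_mul_of_nonneg_left ?_ (by positivity)
  rw [Finset.mul_sum]
  refine Finset.sum_le_sum fun t ht => ?_
  rw [Finset.mem_Icc] at ht
  set g : ℕ → ℝ := fun m =>
    (((l - m + t - 1).choose (l - m) * t.choose (2 * m) * b (p - l) t : ℕ) : ℝ) with hg
  have hg0 : ∀ m, 0 ≤ g m := fun m => Nat.cast_nonneg _
  set A := (Finset.range (l + 1)).filter (fun m => 2 * m ≤ t) with hA
  set B := (Finset.range (l + 1)).filter (fun m => 2 * m ≤ t - 1) with hB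
  change ∑ m ∈ A, g m ≤ 2 * ∑ m ∈ B, g m
  have hBA : B ⊆ A := by
    intro m hm
    rw [hB, Finset.mem_filter] at hm
    rw [hA, Finset.mem_filter]
    exact ⟨hm.1, by omega⟩
  rw [← Finset.sum_sdiff hBA, two_mul]
  refine add_le_add_left ?_ _
  have hmem : ∀ m ∈ A \ B, 1 ≤ m ∧ m ≤ l ∧ t = 2 * m := by
    intro m hm
    rw [Finset.mem_sdiff, hA, hB, Finset.mem_filter, Finset.mem_filter, Finset.mem_range] at hm
    omega
  calc ∑ m ∈ A \ B, g m ≤ ∑ m ∈ A \ B, g (m - 1) := by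
        refine Finset.sum_le_sum fun m hm => ?_
        obtain ⟨h1, h2, h3⟩ := hmem m hm
        obtain ⟨k, rfl⟩ : ∃ k, m = k + 1 := ⟨m - 1, by omega⟩
        rw [hg]
        simp only [Nat.add_sub_cancel]
        have := Nat.mul_le_mul_right (b (p - l) t) (last_term_le l k h2)
        rw [← h3] at this ⊢
        exact_mod_cast this
    _ = ∑ m ∈ (A \ B).image (fun m => m - 1), g m := by
        rw [Finset.sum_image]
        intro a ha c hc h
        have h1 := hmem a (Finset.mem_coe.1 ha)
        have h2 := hmem c (Finset.mem_coe.1 hc)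
        simp only at h
        omega
    _ ≤ ∑ m ∈ B, g m := by
        refine Finset.sum_le_sum_of_subset_of_nonneg ?_ fun m _ _ => hg0 m
        intro k hk
        obtain ⟨m, hm, rfl⟩ := Finset.mem_image.1 hk
        have := hmem m hm
        rw [hB, Finset.mem_filter, Finset.mem_range]
        omega

/-! ### Growth of the comparison sum -/

theorem pow_add_inv_eq_sum (p : ℕ) {M : ℝ} (hM : 0 < M) :
    (M + 1 / M) ^ (2 * p + 1) =
      ∑ k ∈ Finset.range (p + 1), M ^ (2 * k + 1) * ((2 * p + 1).choose (p + k + 1) : ℝ) +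
      ∑ k ∈ Finset.range (p + 1), (1 / M) ^ (2 * k + 1) *
        ((2 * p + 1).choose (p + k + 1) : ℝ) := by
  rw [add_pow, show 2 * p + 1 + 1 = (p + 1) + (p + 1) by ring, Finset.sum_range_add, add_comm]
  congr 1
  · refine Finset.sum_congr rfl fun k hk => ?_
    rw [Finset.mem_range] at hk
    rw [show p + 1 + k = p + k + 1 by ring]
    congr 1
    rw [show 2 * p + 1 - (p + k + 1) = p - k by omega,
      show p + k + 1 = (2 * k + 1) + (p - k) by omega, pow_add, mul_assoc, ← mul_pow,
      mul_one_div_cancel hM.ne', one_pow, mul_one]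
  · rw [← Finset.sum_range_reflect]
    refine Finset.sum_congr rfl fun k hk => ?_
    rw [Finset.mem_range] at hk
    rw [Nat.choose_symm_of_eq_add (show 2 * p + 1 = p + 1 - 1 - k + (p + k + 1) by omega)]
    congr 1
    rw [show 2 * p + 1 - (p + 1 - 1 - k) = (p + 1 - 1 - k) + (2 * k + 1) by omega, pow_add,
      ← mul_assoc, ← mul_pow, mul_one_div_cancel hM.ne', one_pow, one_mul]

theorem comparisonSum_le_sum_range (p : ℕ) {M : ℝ} (hM : 0 < M) :
    M * comparisonSum p M ≤
      ∑ k ∈ Finset.range (p + 1), M ^ (2 * k + 1) * ((2 * p + 1).choose (p + k + 1) : ℝ) := by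
  rw [comparisonSum, Finset.mul_sum]
  calc _ = ∑ k ∈ Finset.Icc 1 (p - 1), M ^ (2 * k + 1) * ((2 * p + 1).choose (p + k + 1) : ℝ) :=
        Finset.sum_congr rfl fun k _ => by ring
    _ ≤ _ := by
      refine Finset.sum_le_sum_of_subset_of_nonneg ?_ fun k _ _ => by positivity
      intro k hk
      rw [Finset.mem_Icc] at hk
      rw [Finset.mem_range]
      omega

theorem comparisonSum_le_pow (p : ℕ) {M : ℝ} (hM : 0 < M) :
    M * comparisonSum p M ≤ (M + 1 / M) ^ (2 * p + 1) := by
  rw [pow_add_inv_eq_sum p hM]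
  exact (comparisonSum_le_sum_range p hM).trans (le_add_of_nonneg_right (by positivity))

theorem single_le_comparisonSum {p l : ℕ} {M : ℝ} (hM : 0 < M) (h1 : 1 ≤ l) (h2 : l ≤ p - 1) :
    M ^ (2 * l) * ((2 * p + 1).choose (p + l + 1) : ℝ) ≤ comparisonSum p M :=
  Finset.single_le_sum (f := fun l => M ^ (2 * l) * ((2 * p + 1).choose (p + l + 1) : ℝ))
    (fun l _ => by positivity) (Finset.mem_Icc.2 ⟨h1, h2⟩)

/-- Consecutive coefficients have ratio `(p+2)/p ≤ 3`. This lets the term `l = 1` replace the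
missing term `l = 0`. -/
theorem choose_middle_le (p : ℕ) (hp : 1 ≤ p) :
    (2 * p + 1).choose (p + 1) ≤ 3 * (2 * p + 1).choose (p + 2) := by
  have h := Nat.choose_succ_right_eq (2 * p + 1) (p + 1)
  rw [show 2 * p + 1 - (p + 1) = p by omega] at h
  have h2 : (2 * p + 1).choose (p + 1) * p ≤ (3 * (2 * p + 1).choose (p + 2)) * p := by
    rw [← h]
    calc _ ≤ (2 * p + 1).choose (p + 1 + 1) * (3 * p) := Nat.mul_le_mul_left _ (by omega)
      _ = _ := by ring
  exact Nat.le_of_mul_le_mul_right h2 hp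

/-- For `M ≥ 1` the positive powers dominate the negative ones. The missing end terms `l = 0` and `l
= p` are absorbed by the terms `l = 1` and `l = p - 1`, at the cost of the factors `3` and `M ^ 2`.
-/
theorem pow_le_comparisonSum {p : ℕ} (hp : 2 ≤ p) {M : ℝ} (hM : 1 ≤ M) :
    (M + 1 / M) ^ (2 * p + 1) ≤ 2 * M * (4 + M ^ 2) * comparisonSum p M := by
  have hM0 : 0 < M := by linarith
  have h1 : ∑ k ∈ Finset.range (p + 1), (1 / M) ^ (2 * k + 1) *
      ((2 * p + 1).choose (p + k + 1) : ℝ) ≤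
      ∑ k ∈ Finset.range (p + 1), M ^ (2 * k + 1) * ((2 * p + 1).choose (p + k + 1) : ℝ) := by
    refine Finset.sum_le_sum fun k _ => ?_
    have : 1 / M ≤ M := ((div_le_one hM0).2 hM).trans hM
    gcongr
  have h2 : ∑ k ∈ Finset.range (p + 1), M ^ (2 * k + 1) *
      ((2 * p + 1).choose (p + k + 1) : ℝ) = M * (comparisonSum p M +
        ((2 * p + 1).choose (p + 1) : ℝ) + M ^ (2 * p)) := by
    rw [Finset.sum_range_succ, Finset.range_eq_Ico, Finset.sum_eq_sum_Ico_succ_bot (by omega),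
      comparisonSum, show Finset.Icc 1 (p - 1) = Finset.Ico (0 + 1) p by
        ext k; simp only [Finset.mem_Icc, Finset.mem_Ico]; omega, mul_add, mul_add, Finset.mul_sum]
    rw [show p + p + 1 = 2 * p + 1 by ring, Nat.choose_self]
    simp only [add_zero, mul_zero, zero_add, pow_one, Nat.cast_one, mul_one]
    rw [add_comm (M * _)]
    congr 1
    · congr 1
      exact Finset.sum_congr rfl fun k _ => by ring
    · ring
  have h3 : ((2 * p + 1).choose (p + 1) : ℝ) ≤ 3 * comparisonSum p M := by
    have e1 : ((2 * p + 1).choose (p + 1) : ℝ) ≤ 3 * (2 * p + 1).choose (p + 2) := by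
      exact_mod_cast choose_middle_le p (by omega)
    have e2 := single_le_comparisonSum (p := p) (l := 1) hM0 le_rfl (by omega)
    rw [show p + 1 + 1 = p + 2 by ring] at e2
    have e3 : (1 : ℝ) ≤ M ^ (2 * 1) := one_le_pow₀ hM
    have e4 : (0 : ℝ) ≤ ((2 * p + 1).choose (p + 2) : ℝ) := Nat.cast_nonneg _
    nlinarith
  have h4 : M ^ (2 * p) ≤ M ^ 2 * comparisonSum p M := by
    have e2 := single_le_comparisonSum (p := p) (l := p - 1) hM0 (by omega) le_rfl
    have e3 : (1 : ℝ) ≤ ((2 * p + 1).choose (p + (p - 1) + 1) : ℝ) := by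
      exact_mod_cast Nat.choose_pos (by omega)
    calc M ^ (2 * p) = M ^ 2 * M ^ (2 * (p - 1)) := by
          rw [← pow_add]; congr 1; omega
      _ ≤ M ^ 2 * (M ^ (2 * (p - 1)) * ((2 * p + 1).choose (p + (p - 1) + 1) : ℝ)) := by
          refine mul_le_mul_of_nonneg_left ?_ (by positivity)
          exact le_mul_of_one_le_right (by positivity) e3
      _ ≤ _ := mul_le_mul_of_nonneg_left e2 (by positivity)
  rw [pow_add_inv_eq_sum p hM0]
  calc _ ≤ 2 * (M * (comparisonSum p M + ((2 * p + 1).choose (p + 1) : ℝ) + M ^ (2 * p))) := by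
        rw [← h2]; linarith
    _ ≤ 2 * (M * (comparisonSum p M + 3 * comparisonSum p M + M ^ 2 * comparisonSum p M)) := by
        gcongr
    _ = _ := by ring

/-- For `M ≤ 1` the mass is near the middle, so the single term `l = 1` already has the right
exponential growth. -/
theorem four_pow_le_comparisonSum {p : ℕ} (hp : 2 ≤ p) {M : ℝ} (hM : 0 < M) :
    M ^ 2 * 4 ^ p ≤ 3 * (2 * p + 1) * comparisonSum p M := by
  have h1 : 4 ^ p ≤ (2 * p + 1) * (3 * (2 * p + 1).choose (p + 2)) := by
    calc 4 ^ p ≤ (2 * p + 1) * (2 * p).choose p := Nat.four_pow_le_two_mul_add_one_mul_central_binom p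
      _ ≤ (2 * p + 1) * (2 * p + 1).choose (p + 1) := by
        refine Nat.mul_le_mul_left _ ?_
        rw [Nat.choose_succ_succ']
        exact Nat.le_add_right _ _
      _ ≤ _ := Nat.mul_le_mul_left _ (choose_middle_le p (by omega))
  have h2 : (4 : ℝ) ^ p ≤ (2 * p + 1) * (3 * (2 * p + 1).choose (p + 2)) := by exact_mod_cast h1
  have h3 := single_le_comparisonSum (p := p) (l := 1) hM le_rfl (by omega)
  rw [show p + 1 + 1 = p + 2 by ring, mul_one] at h3
  calc M ^ 2 * 4 ^ p ≤ M ^ 2 * ((2 * p + 1) * (3 * (2 * p + 1).choose (p + 2))) := by gcongr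
    _ = 3 * (2 * p + 1) * (M ^ 2 * (2 * p + 1).choose (p + 2)) := by ring
    _ ≤ _ := by gcongr

theorem f_pos {M : ℝ} (hM : 0 < M) : 0 < f M := by
  rw [f]
  split_ifs <;> positivity

theorem comparisonSum_bounds {M : ℝ} (hM : 0 < M) :
    ∃ c > 0, ∃ C > 0, ∀ p : ℕ, 2 ≤ p →
      c * f M ^ (2 * p) ≤ ((p : ℝ) + 1) * comparisonSum p M ∧
      comparisonSum p M ≤ C * f M ^ (2 * p) := by
  by_cases h1 : M ≤ 1
  · refine ⟨M ^ 2 / 6, by positivity, 2, by norm_num, fun p hp => ?_⟩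
    rw [f, if_pos h1, pow_mul, show (2 : ℝ) ^ 2 = 4 by norm_num]
    constructor
    · have h2 := four_pow_le_comparisonSum hp hM
      have h3 : 0 ≤ comparisonSum p M := Finset.sum_nonneg fun l _ => by positivity
      nlinarith
    · have h2 := comparisonSum_le_pow p one_pos
      norm_num [pow_succ, pow_mul] at h2
      refine le_trans (Finset.sum_le_sum fun l _ => ?_) (h2.trans_eq (mul_comm _ _))
      have := pow_le_one₀ (n := 2 * l) hM.le h1
      rw [one_pow]
      gcongr
  · have h1 := (not_le.1 h1).le
    have hf : f M = M + 1 / M := by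
      rcases h1.eq_or_lt with rfl | h
      · norm_num [f]
      · rw [f, if_neg (not_le.2 h)]
    have hf0 : 0 < M + 1 / M := by positivity
    rw [hf]
    refine ⟨(M + 1 / M) / (2 * M * (4 + M ^ 2)), by positivity, (M + 1 / M) / M, by positivity,
      fun p hp => ?_⟩
    constructor
    · have h2 := pow_le_comparisonSum hp h1
      have h3 : 0 ≤ comparisonSum p M := Finset.sum_nonneg fun l _ => by positivity
      rw [div_mul_eq_mul_div, div_le_iff₀ (by positivity), ← pow_succ']
      refine h2.trans ?_
      have h4 : 0 ≤ 2 * M * (4 + M ^ 2) * comparisonSum p M := by positivity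
      have h5 : (0 : ℝ) ≤ p := Nat.cast_nonneg p
      nlinarith [mul_nonneg h5 h4]
    · rw [div_mul_eq_mul_div, le_div_iff₀ hM, ← pow_succ', mul_comm]
      exact comparisonSum_le_pow p hM

/-! ### Limits of the `2p`-th roots -/

theorem tendsto_root_poly {c : ℝ} (hc : 0 < c) (r : ℝ) :
    Tendsto (fun p : ℕ => (c * ((p : ℝ) + 1) ^ r) ^ (1 / (2 * (p : ℝ)))) atTop (𝓝 1) := by
  have h1 : Tendsto (fun p : ℕ => Real.log ((p : ℝ) + 1) / (2 * (p : ℝ))) atTop (𝓝 0) := by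
    -- With argument `p + 1`, the denominator `2 (p + 1) - 2` is `2p`.
    have h := (Real.tendsto_pow_log_div_mul_add_atTop 2 (-2) 1 two_ne_zero).comp
      (tendsto_atTop_add_const_right atTop (1 : ℝ) tendsto_natCast_atTop_atTop)
    refine h.congr fun p => ?_
    simp only [Function.comp_apply, pow_one]
    congr 1
    ring
  have h2 : Tendsto (fun p : ℕ => Real.log c / (2 * (p : ℝ))) atTop (𝓝 0) :=
    tendsto_const_nhds.div_atTop (tendsto_natCast_atTop_atTop.const_mul_atTop two_pos)
  have h3 := (Real.continuous_exp.tendsto _).comp (h2.add (h1.const_mul r))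
  rw [mul_zero, add_zero, Real.exp_zero] at h3
  refine h3.congr fun p => ?_
  have hp : (0 : ℝ) < p + 1 := by positivity
  rw [Function.comp_apply, Real.rpow_def_of_pos (by positivity),
    Real.log_mul hc.ne' (by positivity), Real.log_rpow hp]
  congr 1
  ring

/-- A sequence which agrees with `F ^ (2p)` up to polynomial factors has `2p`-th roots converging
to `F`. -/
theorem tendsto_root_of_bounds {u : ℕ → ℝ} {F c C r R : ℝ} (hF : 0 < F) (hc : 0 < c) (hC : 0 < C)
    (h : ∀ p : ℕ, 2 ≤ p → c * ((p : ℝ) + 1) ^ r * F ^ (2 * p) ≤ u p ∧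
      u p ≤ C * ((p : ℝ) + 1) ^ R * F ^ (2 * p)) :
    Tendsto (fun p : ℕ => u p ^ (1 / (2 * (p : ℝ)))) atTop (𝓝 F) := by
  have hroot : ∀ (a q : ℝ) (p : ℕ), 0 < a → 2 ≤ p →
      (a * ((p : ℝ) + 1) ^ q * F ^ (2 * p)) ^ (1 / (2 * (p : ℝ))) =
        (a * ((p : ℝ) + 1) ^ q) ^ (1 / (2 * (p : ℝ))) * F := by
    intro a q p ha hp
    rw [Real.mul_rpow (by positivity) (by positivity)]
    congr 1
    rw [show 1 / (2 * (p : ℝ)) = ((2 * p : ℕ) : ℝ)⁻¹ by push_cast; rw [one_div]]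
    exact Real.pow_rpow_inv_natCast hF.le (by omega)
  have h1 := (tendsto_root_poly hc r).mul_const F
  have h2 := (tendsto_root_poly hC R).mul_const F
  rw [one_mul] at h1 h2
  refine tendsto_of_tendsto_of_tendsto_of_le_of_le' h1 h2 ?_ ?_
  · filter_upwards [eventually_ge_atTop 2] with p hp
    rw [← hroot c r p hc hp]
    exact Real.rpow_le_rpow (by positivity) (h p hp).1 (by positivity)
  · filter_upwards [eventually_ge_atTop 2] with p hp
    rw [← hroot C R p hC hp]
    refine Real.rpow_le_rpow (le_trans (by positivity) (h p hp).1) (h p hp).2 (by positivity)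

/-- The exponent `-2` collects one factor `p` from the lower bound on `b` and one from the lower
bound on the comparison sum; `120` comes from the upper bound on `b`. -/
theorem s_bounds {M : ℝ} (hM : 0 < M) :
    ∃ c > 0, ∃ C > 0, ∀ p : ℕ, 2 ≤ p →
      c * ((p : ℝ) + 1) ^ (-2 : ℝ) * f M ^ (2 * p) ≤ s' p M ∧
      s' p M ≤ s p M ∧ s p M ≤ C * ((p : ℝ) + 1) ^ (120 : ℝ) * f M ^ (2 * p) := by
  obtain ⟨c, hc, C, hC, h⟩ := comparisonSum_bounds hM
  refine ⟨c / 8, by positivity, C, hC, fun p hp => ⟨?_, s'_le_s p M hM, ?_⟩⟩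
  · have hp0 : (0 : ℝ) < p + 1 := by positivity
    have h1 := (h p hp).1
    have h2 := comparisonSum_le p M hM
    have h3 := s_le_two_mul_s' p M hM
    have h4 : 0 ≤ s' p M :=
      Finset.sum_nonneg fun l _ => mul_nonneg (by positivity)
        (Finset.sum_nonneg fun t _ => Finset.sum_nonneg fun m _ => Nat.cast_nonneg _)
    rw [Real.rpow_neg hp0.le, show (2 : ℝ) = ((2 : ℕ) : ℝ) by norm_num, Real.rpow_natCast,
      mul_right_comm, ← div_eq_mul_inv, div_le_iff₀ (by positivity)]
    have h5 : comparisonSum p M ≤ 8 * (p + 1) * s' p M := by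
      have : (0 : ℝ) ≤ p := Nat.cast_nonneg p
      calc _ ≤ 4 * p * s p M := h2
        _ ≤ 4 * p * (2 * s' p M) := by gcongr
        _ ≤ _ := by nlinarith
    calc c / 8 * f M ^ (2 * p) = c * f M ^ (2 * p) / 8 := by ring
      _ ≤ ((p + 1) * (8 * (p + 1) * s' p M)) / 8 :=
        div_le_div_of_nonneg_right
          (h1.trans (mul_le_mul_of_nonneg_left h5 hp0.le)) (by norm_num)
      _ = _ := by ring
  · have h1 := (h p hp).2
    have h2 := s_le p M hM
    rw [show (120 : ℝ) = ((120 : ℕ) : ℝ) by norm_num, Real.rpow_natCast]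
    calc _ ≤ _ := h2
      _ ≤ ((p : ℝ) + 1) ^ 120 * (C * f M ^ (2 * p)) := by gcongr
      _ = _ := by ring

end WignerCycles

theorem mainTheorem2 :
    (∀ l t : ℕ, 1 ≤ l → 1 ≤ t → t ≤ l + 1 →
      1 / (4 * (l : ℝ)) * ((2 * l + 1 - t).choose l : ℝ) ≤ (WignerCycles.b l t : ℝ) ∧
      (WignerCycles.b l t : ℝ) ≤ ((l : ℝ) + 1) ^ 120 * ((2 * l + 1 - t).choose l : ℝ)) ∧
    (∀ M : ℝ, 0 < M →
      IsLUB (WignerCycles.h M '' WignerCycles.D)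
        (if M ≤ 1 then 4 else (M ^ 2 + 1) ^ 2 / M ^ 2)) ∧
    (∀ M : ℝ, 0 < M →
      Tendsto (fun p : ℕ => WignerCycles.s p M ^ (1 / (2 * (p : ℝ)))) atTop
        (𝓝 (WignerCycles.f M)) ∧
      Tendsto (fun p : ℕ => WignerCycles.s' p M ^ (1 / (2 * (p : ℝ)))) atTop
        (𝓝 (WignerCycles.f M))) := by
  refine ⟨WignerCycles.b_bounds, fun M hM => WignerCycles.isLUB_h hM, fun M hM => ?_⟩
  obtain ⟨c, hc, C, hC, h⟩ := WignerCycles.s_bounds hM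
  have hF := WignerCycles.f_pos hM
  exact ⟨WignerCycles.tendsto_root_of_bounds hF hc hC fun p hp =>
      ⟨(h p hp).1.trans (h p hp).2.1, (h p hp).2.2⟩,
    WignerCycles.tendsto_root_of_bounds hF hc hC fun p hp =>
      ⟨(h p hp).1, (h p hp).2.1.trans (h p hp).2.2⟩⟩
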